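/- Let $n_t\ge 1$ be an integer, $P>0$, and let $\vec h=(h_1,\dots,h_{n_t})$ be a random row vector whose entries are independent with the circularly symmetric complex Gaussian law $\mathcal{CN}(0,1)$ (independent real and imaginary parts, each $\mathcal N(0,1/2)$); this is the $n_t\times 1$ MISO block Rayleigh fading channel, unknown to the transmitter. For a rate $R\in\mathbb R$ and a transmit covariance matrix $\mathbf Q$ (Hermitian, positive semidefinite, $n_t\times n_t$) with $\operatorname{tr}(\mathbf Q)\le P$, the throughput is $$\mathcal R_s(R,\mathbf Q)=\Pr\{\ln(1+\vec h\,\mathbf Q\,\vec h^{\dagger})\ge R\}\cdot R .$$ Then the maximum throughput $$\mathcal R_s^m=\max_{R,\ \mathbf Q:\ \operatorname{tr}(\mathbf Q)\le P}\ \mathcal R_s(R,\mathbf Q)$$ exists, and it is achieved by the equal power allocation $\mathbf Q^o=\frac{P}{n_t}\mathbf I_{n_t}$ at a suitable rate. This is the only optimal covariance matrix: every maximizing pair $(R,\mathbf Q)$ has $\mathbf Q=\mathbf Q^o$; moreover $0<R<\ln(1+P)$, that is, $R=\ln(1+Ps)$ with $0<s<1$. The maximum throughput is $$\mathcal R_s^m=\max_{0<s<1}\frac{\Gamma(n_t,n_ts)}{(n_t-1)!}\,\ln(1+Ps),$$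 where the maximum over $s$ is attained and $\Gamma(a,x)=\int_x^\infty t^{a-1}e^{-t}\,dt$ is the upper incomplete gamma function. -/

import Mathlib

open MeasureTheory ProbabilityTheory
open scoped ComplexOrder

noncomputable section

namespace Miso

/-- The circularly symmetric complex Gaussian law `CN(0,1)`: independent real and imaginary
parts, each centred Gaussian with variance `1/2`. -/
def stdComplexGaussian : Measure ℂ :=
  ((gaussianReal 0 (1 / 2)).prod (gaussianReal 0 (1 / 2))).map
    (fun p : ℝ × ℝ => (⟨p.1, p.2⟩ : ℂ))

/-- The `n × 1` MISO Rayleigh channel vector: the coefficients are i.i.d. `CN(0,1)`. -/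
structure IsRayleighChannel {Ω : Type*} [MeasurableSpace Ω] {n : ℕ}
    (h : Fin n → Ω → ℂ) (μ : Measure Ω) : Prop where
  hasLaw : ∀ i, HasLaw (h i) stdComplexGaussian μ
  indep : iIndepFun h μ

/-- Transmit covariance matrices (Hermitian, nonnegative definite) with total power at most `P`. -/
def admissibleCovariances (n : ℕ) (P : ℝ) : Set (Matrix (Fin n) (Fin n) ℂ) :=
  {Q | Q.PosSemidef ∧ Q.trace.re ≤ P}

/-- Instantaneous mutual information `ln (1 + v Q v†)` (in nats) for the channel row vector `v`.
The quadratic form is real when `Q` is Hermitian. -/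
def mutualInformation {n : ℕ} (Q : Matrix (Fin n) (Fin n) ℂ) (v : Fin n → ℂ) : ℝ :=
  Real.log (1 + (v ⬝ᵥ Q.mulVec (star v)).re)

/-- Throughput: the rate `R` times the probability of successful transmission. -/
def throughput {Ω : Type*} [MeasurableSpace Ω] {n : ℕ} (μ : Measure Ω) (h : Fin n → Ω → ℂ)
    (Q : Matrix (Fin n) (Fin n) ℂ) (R : ℝ) : ℝ :=
  μ.real {ω | R ≤ mutualInformation Q (fun i => h i ω)} * R

/-- Equal power on all antennas with uncorrelated signals: `(P / n) I`. -/
def equalPower (n : ℕ) (P : ℝ) : Matrix (Fin n) (Fin n) ℂ :=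
  ((P / n : ℝ) : ℂ) • (1 : Matrix (Fin n) (Fin n) ℂ)

/-- The upper incomplete gamma function. -/
def upperIncompleteGamma (a x : ℝ) : ℝ :=
  ∫ t in Set.Ioi x, t ^ (a - 1) * Real.exp (-t)

end Miso

end

/-! Diagonalizing `Q` and using the unitary invariance of the Gaussian vector, the gain `h Q h†` has
the law of `∑ λᵢ Eᵢ`, with `λᵢ` the eigenvalues and `Eᵢ` independent standard exponentials
(`measure_le_quadForm`). With `R = log (1 + x)`, the task is to maximize `Pr{∑ λᵢ Eᵢ ≥ x} * log (1 +
x)` subject to `∑ λᵢ ≤ P`.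

Below the level `x = P`, equal coefficients are the unique minimizer of the distribution function.
Replacing `a, b` by `c, d` with the same sum changes it by `(cd - ab)` times the second derivative
of the distribution function with all of `a, b, c, d` present (`hypoexpCDF_transfer_lt`). That
derivative is positive up to the sum of all coefficients but the largest (`second_deriv_pos`), by a
dilation identity evaluated at its first zero. Repeated transfers lead to equal coefficients
(`hypoexpCDF_replicate_lt`).

At levels `x = P s` with `s ≥ 1` equal powers need not be best, so these levels are excluded
altogether. Sums of exponentials have an increasing hazard rate, so the tail at `P s` is at most the
`s`-th power of the tail at `P` (`tail_mul_le_rpow`), and the latter is at most its equal-power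
value `erlangTail n n`. The resulting bound is strictly below the equal-power throughput at some
level `P c` with `c < 1` (`exists_better`). What remains is a continuous function of one variable on
`[0, 1]`, maximal at an interior point (`exists_isMaxOn_erlangTail`). -/

namespace Miso

noncomputable section

/-! ### Exponential convolutions and hypoexponential distribution functions. -/

/-- The operator sending `φ` to the solution `u` of `a u' + u = φ`, `u 0 = 0`; for `a > 0` it is
convolution with the exponential law of mean `a`. For `a = 0` it is the identity. -/
def expConv (a : ℝ) (φ : C(ℝ, ℝ)) : C(ℝ, ℝ) :=
  if a = 0 then φ else
    ⟨fun x => Real.exp (-(x / a)) * ∫ y in (0 : ℝ)..x, φ y * Real.exp (y / a) / a, by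
      have h : Continuous fun y => φ y * Real.exp (y / a) / a := by fun_prop
      exact (by fun_prop : Continuous fun x : ℝ => Real.exp (-(x / a))).mul
        (intervalIntegral.continuous_primitive (fun _ _ => h.intervalIntegrable _ _) 0)⟩

@[simp] lemma expConv_zero_left (φ : C(ℝ, ℝ)) : expConv 0 φ = φ := by simp [expConv]

lemma expConv_apply {a : ℝ} (ha : a ≠ 0) (φ : C(ℝ, ℝ)) (x : ℝ) :
    expConv a φ x = Real.exp (-(x / a)) * ∫ y in (0 : ℝ)..x, φ y * Real.exp (y / a) / a := by
  simp [expConv, ha]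

lemma expConv_apply_zero {a : ℝ} (ha : a ≠ 0) (φ : C(ℝ, ℝ)) : expConv a φ 0 = 0 := by
  simp [expConv_apply ha]

/-- `ψ` is the derivative of `φ` on the whole line. -/
def HasD (φ ψ : C(ℝ, ℝ)) : Prop := ∀ x, HasDerivAt φ (ψ x) x

lemma HasD.unique {φ ψ χ : C(ℝ, ℝ)} (h : HasD φ ψ) (h' : HasD φ χ) : ψ = χ :=
  ContinuousMap.ext fun x => (h x).unique (h' x)

lemma HasD.add {φ ψ φ' ψ' : C(ℝ, ℝ)} (h : HasD φ φ') (h' : HasD ψ ψ') :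
    HasD (φ + ψ) (φ' + ψ') := fun x => (h x).add (h' x)

lemma HasD.sub {φ ψ φ' ψ' : C(ℝ, ℝ)} (h : HasD φ φ') (h' : HasD ψ ψ') :
    HasD (φ - ψ) (φ' - ψ') := fun x => (h x).sub (h' x)

lemma HasD.smul {φ φ' : C(ℝ, ℝ)} (c : ℝ) (h : HasD φ φ') : HasD (c • φ) (c • φ') :=
  fun x => (h x).const_smul c

lemma hasD_const (c : ℝ) : HasD (ContinuousMap.const ℝ c) 0 := fun x => hasDerivAt_const x c

lemma hasD_expConv {a : ℝ} (ha : a ≠ 0) (φ : C(ℝ, ℝ)) :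
    HasD (expConv a φ) (a⁻¹ • (φ - expConv a φ)) := by
  intro x
  have h : Continuous fun y => φ y * Real.exp (y / a) / a := by fun_prop
  have h1 : HasDerivAt (fun x => ∫ y in (0 : ℝ)..x, φ y * Real.exp (y / a) / a)
      (φ x * Real.exp (x / a) / a) x :=
    intervalIntegral.integral_hasDerivAt_right (h.intervalIntegrable _ _)
      (h.stronglyMeasurableAtFilter _ _) h.continuousAt
  have h2 : HasDerivAt (fun x : ℝ => Real.exp (-(x / a))) (Real.exp (-(x / a)) * -(1 / a)) x :=
    (((hasDerivAt_id x).div_const a).neg).exp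
  have h3 := h2.mul h1
  have he : Real.exp (-(x / a)) * Real.exp (x / a) = 1 := by rw [← Real.exp_add]; simp
  have : (expConv a φ : ℝ → ℝ) =
      (fun x => Real.exp (-(x / a))) * fun x => ∫ y in (0 : ℝ)..x, φ y * Real.exp (y / a) / a := by
    ext y; exact expConv_apply ha φ y
  rw [this]
  refine h3.congr_deriv ?_
  simp only [ContinuousMap.smul_apply, ContinuousMap.sub_apply, smul_eq_mul, expConv_apply ha]
  linear_combination (φ x / a) * he

/-- The difference of two solutions, multiplied by `exp (x / a)`, has zero derivative. Most
identities for `expConv` below are obtained by checking the differential equation. -/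
lemma expConv_unique {a : ℝ} (ha : a ≠ 0) {φ u : C(ℝ, ℝ)} (h0 : u 0 = 0)
    (h : HasD u (a⁻¹ • (φ - u))) : u = expConv a φ := by
  have hd := h.sub (hasD_expConv ha φ)
  set w := u - expConv a φ with hw
  have hw0 : w 0 = 0 := by simp [hw, h0, expConv_apply_zero ha]
  have h2 : ∀ x, HasDerivAt (fun x => w x * Real.exp (x / a)) 0 x := by
    intro x
    have e1 : HasDerivAt (fun x : ℝ => Real.exp (x / a)) (Real.exp (x / a) * (1 / a)) x :=
      (((hasDerivAt_id x).div_const a)).exp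
    refine ((hd x).mul e1).congr_deriv ?_
    simp only [hw, ContinuousMap.smul_apply, ContinuousMap.sub_apply, smul_eq_mul]
    ring
  have h3 : ∀ x, w x = 0 := by
    intro x
    have := is_const_of_deriv_eq_zero (fun y => (h2 y).differentiableAt) (fun y => (h2 y).deriv) x 0
    simpa [hw0] using this
  ext x
  have := h3 x
  simp only [hw, ContinuousMap.sub_apply] at this
  linarith

lemma expConv_add (a : ℝ) (φ ψ : C(ℝ, ℝ)) : expConv a (φ + ψ) = expConv a φ + expConv a ψ := by
  by_cases ha : a = 0
  · simp [ha]
  · symm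
    apply expConv_unique ha
    · simp [expConv_apply_zero ha]
    · have := (hasD_expConv ha φ).add (hasD_expConv ha ψ)
      rwa [show a⁻¹ • (φ + ψ - (expConv a φ + expConv a ψ)) =
        a⁻¹ • (φ - expConv a φ) + a⁻¹ • (ψ - expConv a ψ) by rw [← smul_add]; congr 1; abel]

lemma expConv_smul (a c : ℝ) (φ : C(ℝ, ℝ)) : expConv a (c • φ) = c • expConv a φ := by
  by_cases ha : a = 0
  · simp [ha]
  · symm
    apply expConv_unique ha
    · simp [expConv_apply_zero ha]
    · have := (hasD_expConv ha φ).smul c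
      rwa [show a⁻¹ • (c • φ - c • expConv a φ) = c • a⁻¹ • (φ - expConv a φ) by
        rw [← smul_sub, smul_comm]]

/-- `expConv a` as a linear map. -/
def expConvLin (a : ℝ) : C(ℝ, ℝ) →ₗ[ℝ] C(ℝ, ℝ) where
  toFun := expConv a
  map_add' := expConv_add a
  map_smul' := expConv_smul a

lemma expConvLin_apply (a : ℝ) (φ : C(ℝ, ℝ)) : expConvLin a φ = expConv a φ := rfl

lemma expConv_sub (a : ℝ) (φ ψ : C(ℝ, ℝ)) : expConv a (φ - ψ) = expConv a φ - expConv a ψ :=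
  map_sub (expConvLin a) φ ψ

/-- Partial fractions: for `a ≠ b` the composition is `(a - b)⁻¹ • (a • expConv a φ - b • expConv b
φ)`, which is symmetric in `a` and `b`. Commutativity is what allows folding over a multiset. -/
lemma expConv_comm (a b : ℝ) (φ : C(ℝ, ℝ)) :
    expConv a (expConv b φ) = expConv b (expConv a φ) := by
  by_cases ha : a = 0
  · simp [ha]
  by_cases hb : b = 0
  · simp [hb]
  by_cases hab : a = b
  · rw [hab]
  have hab' : a - b ≠ 0 := sub_ne_zero.mpr hab
  have key : ∀ {a b : ℝ}, a ≠ 0 → b ≠ 0 → a - b ≠ 0 →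
      (a - b)⁻¹ • (a • expConv a φ - b • expConv b φ) = expConv b (expConv a φ) := by
    intro a b ha hb hab'
    apply expConv_unique hb
    · simp [expConv_apply_zero ha, expConv_apply_zero hb]
    · intro x
      refine ((((hasD_expConv ha φ).smul a).sub ((hasD_expConv hb φ).smul b)).smul
        (a - b)⁻¹ x).congr_deriv ?_
      simp only [ContinuousMap.smul_apply, ContinuousMap.sub_apply, smul_eq_mul]
      field_simp
      ring
  rw [← key ha hb hab', ← key hb ha (by rwa [← neg_sub, neg_ne_zero])]
  rw [← neg_sub a b, inv_neg, neg_smul, ← smul_neg, neg_sub]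

instance : LeftCommutative expConv := ⟨expConv_comm⟩

/-- Differentiation passes through the convolution because the boundary term at `0` vanishes. -/
lemma HasD.expConv {φ ψ : C(ℝ, ℝ)} (h : HasD φ ψ) (h0 : φ 0 = 0) (b : ℝ) :
    HasD (expConv b φ) (expConv b ψ) := by
  by_cases hb : b = 0
  · simpa [hb] using h
  have h1 := hasD_expConv hb φ
  have h2 : HasD (b⁻¹ • (φ - Miso.expConv b φ)) (b⁻¹ • (ψ - b⁻¹ • (φ - Miso.expConv b φ))) :=
    (h.sub h1).smul _
  rwa [expConv_unique hb (by simp [h0, expConv_apply_zero hb]) h2] at h1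

lemma expConv_pos {a : ℝ} (ha : 0 < a) {φ : C(ℝ, ℝ)} {x : ℝ} (hx : 0 < x)
    (h : ∀ y ∈ Set.Ioo 0 x, 0 < φ y) : 0 < expConv a φ x := by
  rw [expConv_apply ha.ne']
  refine mul_pos (Real.exp_pos _) ?_
  have hc : Continuous fun y => φ y * Real.exp (y / a) / a := by fun_prop
  refine intervalIntegral.intervalIntegral_pos_of_pos_on (hc.intervalIntegrable _ _) ?_ hx
  intro y hy
  have := h y hy
  positivity

/-- The distribution function of `∑ aᵢ Eᵢ` on the positive half-line, where `aᵢ` runs through the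
multiset `s` and the `Eᵢ` are independent standard exponential variables. -/
def hypoexpCDF (s : Multiset ℝ) : C(ℝ, ℝ) := s.foldr expConv 1

@[simp] lemma hypoexpCDF_zero : hypoexpCDF 0 = 1 := rfl

@[simp] lemma hypoexpCDF_cons (a : ℝ) (s : Multiset ℝ) :
    hypoexpCDF (a ::ₘ s) = expConv a (hypoexpCDF s) := Multiset.foldr_cons _ _ _ _

lemma hypoexpCDF_filter (s : Multiset ℝ) :
    hypoexpCDF (s.filter (· ≠ 0)) = hypoexpCDF s := by
  induction s using Multiset.induction_on with
  | empty => simp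
  | cons a s ih =>
    by_cases ha : a = 0
    · rw [Multiset.filter_cons_of_neg _ (by simpa using ha), ih, ha, hypoexpCDF_cons,
        expConv_zero_left]
    · rw [Multiset.filter_cons_of_pos (p := (· ≠ 0)) _ ha, hypoexpCDF_cons, hypoexpCDF_cons, ih]

/-- `aF' + F` recovers the distribution function with the coefficient `a` deleted. -/
lemma hypoexpCDF_eq_add_deriv {a : ℝ} {s : Multiset ℝ} {f : C(ℝ, ℝ)}
    (hf : HasD (hypoexpCDF (a ::ₘ s)) f) :
    hypoexpCDF s = hypoexpCDF (a ::ₘ s) + a • f := by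
  by_cases ha : a = 0
  · simp [ha]
  · rw [hypoexpCDF_cons] at hf ⊢
    rw [hf.unique (hasD_expConv ha _), smul_inv_smul₀ ha]
    abel

lemma hypoexpCDF_apply_zero {s : Multiset ℝ} (hs : ∀ a ∈ s, 0 < a) (h : s ≠ 0) :
    hypoexpCDF s 0 = 0 := by
  obtain ⟨a, ha⟩ := Multiset.exists_mem_of_ne_zero h
  obtain ⟨t, rfl⟩ := Multiset.exists_cons_of_mem ha
  rw [hypoexpCDF_cons, expConv_apply_zero (hs a ha).ne']

lemma expConv_one {a : ℝ} (ha : a ≠ 0) (x : ℝ) : expConv a 1 x = 1 - Real.exp (-(x / a)) := by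
  have : expConv a 1 = ⟨fun x => 1 - Real.exp (-(x / a)), by fun_prop⟩ := by
    symm
    apply expConv_unique ha
    · simp
    · intro x
      have h2 : HasDerivAt (fun x : ℝ => Real.exp (-(x / a)))
        (Real.exp (-(x / a)) * -(1 / a)) x := (((hasDerivAt_id x).div_const a).neg).exp
      refine (h2.const_sub 1).congr_deriv ?_
      simp
      ring
  simp [this]

lemma exists_density {s : Multiset ℝ} (hs : ∀ a ∈ s, 0 < a) (h : s ≠ 0) :
    ∃ f, HasD (hypoexpCDF s) f ∧ ∀ x, 0 < x → 0 < f x := by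
  induction s using Multiset.induction_on with
  | empty => exact absurd rfl h
  | cons a s ih =>
    have ha : 0 < a := hs a (by simp)
    have hs' : ∀ b ∈ s, 0 < b := fun b hb => hs b (by simp [hb])
    by_cases hz : s = 0
    · subst hz
      refine ⟨_, by rw [hypoexpCDF_cons]; exact hasD_expConv ha.ne' _, fun x hx => ?_⟩
      simp [expConv_one ha.ne']
      positivity
    · obtain ⟨f, hf, hp⟩ := ih hs' hz
      refine ⟨_, by rw [hypoexpCDF_cons]; exact hf.expConv (hypoexpCDF_apply_zero hs' hz) a,
        fun x hx => expConv_pos ha hx fun y hy => hp y hy.1⟩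

/-- With two coefficients `a, b` the second derivative at `0` is `1 / (a b) > 0`, so it is positive
nearby; each further convolution preserves positivity on the same interval. -/
lemma exists_second_deriv {s : Multiset ℝ} (hs : ∀ a ∈ s, 0 < a) (h : 2 ≤ s.card) :
    ∃ f g, HasD (hypoexpCDF s) f ∧ HasD f g ∧ f 0 = 0 ∧
      ∃ δ > 0, ∀ x ∈ Set.Ioo 0 δ, 0 < g x := by
  induction s using Multiset.induction_on with
  | empty => simp at h
  | cons a s ih =>
    have ha : 0 < a := hs a (by simp)
    have hs' : ∀ b ∈ s, 0 < b := fun b hb => hs b (by simp [hb])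
    have hcard : 1 ≤ s.card := by simpa using h
    have hz : s ≠ 0 := by rintro rfl; simp at hcard
    rcases hcard.lt_or_eq with hc | hc
    · obtain ⟨f, g, hf, hg, h0, δ, hδ, hp⟩ := ih hs' hc
      refine ⟨_, _, by rw [hypoexpCDF_cons]; exact hf.expConv (hypoexpCDF_apply_zero hs' hz) a,
        hg.expConv h0 a, expConv_apply_zero ha.ne' _, δ, hδ, fun x hx =>
          expConv_pos ha hx.1 fun y hy => hp y ⟨hy.1, hy.2.trans hx.2⟩⟩
    · obtain ⟨b, rfl⟩ := Multiset.card_eq_one.mp hc.symm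
      have hb : 0 < b := hs' b (by simp)
      set e := b⁻¹ • (1 - expConv b 1) with he
      have h1 : HasD (hypoexpCDF {b}) e := hasD_expConv hb.ne' 1
      have h2 := hasD_expConv ha.ne' e
      refine ⟨expConv a e, _, by
        rw [hypoexpCDF_cons]; exact h1.expConv (hypoexpCDF_apply_zero hs' hz) a, h2,
        expConv_apply_zero ha.ne' _, ?_⟩
      set g := a⁻¹ • (e - expConv a e) with hg
      have hg0 : 0 < g 0 := by
        simp [hg, he, expConv_apply_zero ha.ne', expConv_apply_zero hb.ne', ha, hb]
      obtain ⟨δ, hδ, hball⟩ := Metric.eventually_nhds_iff.mp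
        ((g.continuous.tendsto 0).eventually (lt_mem_nhds hg0))
      refine ⟨δ, hδ, fun x hx => hball ?_⟩
      rw [Real.dist_eq, sub_zero, abs_of_pos hx.1]
      exact hx.2

/-- The dilation identity `x F' = N F - ∑ F_{aᵢ}`, where the coefficient `aᵢ` is doubled
in `F_{aᵢ}`. -/
lemma mul_density_eq {s : Multiset ℝ} (hs : ∀ a ∈ s, 0 < a) {f : C(ℝ, ℝ)}
    (hf : HasD (hypoexpCDF s) f) :
    ContinuousMap.id ℝ * f =
      (s.card : ℝ) • hypoexpCDF s - (s.map fun a => hypoexpCDF (a ::ₘ s)).sum := by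
  induction s using Multiset.induction_on generalizing f with
  | empty =>
    have : f = 0 := hf.unique (hasD_const 1)
    simp [this]
  | cons b s ih =>
    have hb : 0 < b := hs b (by simp)
    have hs' : ∀ a ∈ s, 0 < a := fun a ha => hs a (by simp [ha])
    have hsum : (s.map fun a => hypoexpCDF (a ::ₘ b ::ₘ s)).sum =
        expConv b (s.map fun a => hypoexpCDF (a ::ₘ s)).sum := by
      rw [← expConvLin_apply, map_multiset_sum, Multiset.map_map]
      congr 1
      refine Multiset.map_congr rfl fun a _ => ?_
      simp [expConv_comm a b, expConvLin_apply]
    set G := hypoexpCDF s with hG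
    have hff : f = b⁻¹ • (G - expConv b G) := by
      rw [hypoexpCDF_cons] at hf
      exact hf.unique (hasD_expConv hb.ne' _)
    obtain ⟨g, hg⟩ : ∃ g, HasD G g := by
      by_cases hz : s = 0
      · exact ⟨0, by rw [hG, hz]; exact hasD_const 1⟩
      · exact (exists_density hs' hz).imp fun _ h => h.1
    have hfd : HasD f (b⁻¹ • (g - f)) := by
      have := (hg.sub (hasD_expConv hb.ne' G)).smul b⁻¹
      rwa [← hff] at this
    -- From `b f' = g - f`, the function `x f` solves the equation of `expConv b` with source `b f +
    -- x g`; the induction hypothesis rewrites `x g`.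
    have hu : HasD (ContinuousMap.id ℝ * f)
        (b⁻¹ • ((b • f + ContinuousMap.id ℝ * g) - ContinuousMap.id ℝ * f)) := by
      intro x
      refine ((hasDerivAt_id x).mul (hfd x)).congr_deriv ?_
      simp only [ContinuousMap.smul_apply, ContinuousMap.sub_apply, ContinuousMap.add_apply,
        ContinuousMap.mul_apply, ContinuousMap.id_apply, smul_eq_mul, id]
      field_simp
      ring
    rw [expConv_unique hb.ne' (by simp) hu, ih hs' hg, Multiset.map_cons, Multiset.sum_cons, hsum,
      hypoexpCDF_cons, hypoexpCDF_cons, hypoexpCDF_cons, ← hG, hff, smul_inv_smul₀ hb.ne', expConv_add,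
      expConv_sub, expConv_sub, expConv_smul, Multiset.card_cons]
    push_cast
    rw [add_smul, one_smul]
    abel

end

/-! ### Convexity of the distribution function near the origin, and optimality of equal
coefficients. -/

lemma sum_map_sub_eq (s : Multiset ℝ) (c : ℝ) (u : ℝ → ℝ) :
    (s.map fun a => c - u a).sum = s.card * c - (s.map u).sum := by
  induction s using Multiset.induction_on with
  | empty => simp
  | cons a s ih => simp [ih]; ring

lemma continuousMap_sum_map_apply (s : Multiset ℝ) (u : ℝ → C(ℝ, ℝ)) (x : ℝ) :
    (s.map u).sum x = (s.map fun a => u a x).sum := by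
  induction s using Multiset.induction_on with
  | empty => simp
  | cons a s ih => simp [ih]

lemma hasD_sum_map (s : Multiset ℝ) (u v : ℝ → C(ℝ, ℝ)) (h : ∀ a ∈ s, HasD (u a) (v a)) :
    HasD (s.map u).sum (s.map v).sum := by
  induction s using Multiset.induction_on with
  | empty => simpa using hasD_const 0
  | cons a s ih =>
    simp only [Multiset.map_cons, Multiset.sum_cons]
    exact (h a (by simp)).add (ih fun b hb => h b (by simp [hb]))

/-- The density of `∑ aᵢ Eᵢ` is strictly increasing up to the sum of all coefficients but the
largest one. -/
lemma second_deriv_pos {s : Multiset ℝ} (hs : ∀ a ∈ s, 0 < a) (h : 2 ≤ s.card) {f g : C(ℝ, ℝ)}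
    (hf : HasD (hypoexpCDF s) f) (hg : HasD f g) {x : ℝ} (hx : 0 < x)
    (hxs : ∀ a ∈ s, x < s.sum - a) : 0 < g x := by
  have hz : s ≠ 0 := by rintro rfl; simp at h
  obtain ⟨f', hf', hfpos⟩ := exists_density hs hz
  obtain rfl := hf.unique hf'
  obtain ⟨f', g', hf', hg', hf0, δ, hδ, hgδ⟩ := exists_second_deriv hs h
  obtain rfl := hf.unique hf'
  obtain rfl := hg.unique hg'
  clear hf' hg'
  by_contra hneg
  push Not at hneg
  -- the first zero of `g` on the positive half-line
  have hδx : δ ≤ x := by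
    by_contra hlt
    exact absurd (hgδ x ⟨hx, not_le.mp hlt⟩) (not_lt.mpr hneg)
  set A := Set.Icc (δ / 2) x ∩ {y | g y ≤ 0} with hA
  have hAc : IsCompact A :=
    isCompact_Icc.inter_right (isClosed_le g.continuous continuous_const)
  obtain ⟨z, hzA, hzmin⟩ := hAc.exists_isLeast ⟨x, ⟨by linarith, le_rfl⟩, hneg⟩
  have hz0 : 0 < z := lt_of_lt_of_le (by positivity) hzA.1.1
  have hbelow : ∀ y ∈ Set.Ioo 0 z, 0 < g y := by
    intro y hy
    by_contra hle
    push Not at hle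
    rcases lt_or_ge y (δ / 2) with h1 | h1
    · exact absurd (hgδ y ⟨hy.1, by linarith⟩) (not_lt.mpr hle)
    · exact absurd (hzmin ⟨⟨h1, hy.2.le.trans hzA.1.2⟩, hle⟩) (not_le.mpr hy.2)
  have hgz : g z = 0 := by
    refine le_antisymm hzA.2 ?_
    have hcl : z ∈ closure (Set.Ioo 0 z) := by
      rw [closure_Ioo hz0.ne]; exact ⟨hz0.le, le_rfl⟩
    exact closure_minimal (fun y hy => (hbelow y hy).le)
      (isClosed_le continuous_const g.continuous) hcl
  -- the dilation identity and its derivative at `z`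
  have hF0 := hypoexpCDF_apply_zero hs hz
  have hd1 : ∀ a, HasD (hypoexpCDF (a ::ₘ s)) (expConv a f) := fun a => by
    rw [hypoexpCDF_cons]; exact hf.expConv hF0 a
  have hd2 : ∀ a, HasD (expConv a f) (expConv a g) := fun a => hg.expConv hf0 a
  have hid := mul_density_eq hs hf
  have hFa : ∀ a, hypoexpCDF s - hypoexpCDF (a ::ₘ s) = a • expConv a f := fun a => by
    rw [hypoexpCDF_eq_add_deriv (hd1 a)]; abel
  have hfa : ∀ a ∈ s, f - expConv a f = a • expConv a g := fun a ha => by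
    rw [(hd2 a).unique (hasD_expConv (hs a ha).ne' f), smul_inv_smul₀ (hs a ha).ne']
  have hI0 : z * f z = (s.map fun a => a * expConv a f z).sum := by
    have := congrArg (fun φ : C(ℝ, ℝ) => φ z) hid
    simp only [ContinuousMap.mul_apply, ContinuousMap.id_apply, ContinuousMap.sub_apply,
      ContinuousMap.smul_apply, smul_eq_mul, continuousMap_sum_map_apply] at this
    rw [this, ← sum_map_sub_eq]
    congr 1
    refine Multiset.map_congr rfl fun a _ => ?_
    simpa using congrArg (fun φ : C(ℝ, ℝ) => φ z) (hFa a)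
  have hI1 : f z + z * g z = (s.map fun a => f z - expConv a f z).sum := by
    have e1 : HasDerivAt (ContinuousMap.id ℝ * f) (1 * f z + z * g z) z :=
      (hasDerivAt_id z).mul (hg z)
    have e2 := (hf.smul (s.card : ℝ)).sub (hasD_sum_map s _ _ fun a _ => hd1 a)
    rw [← hid] at e2
    have := e1.unique (e2 z)
    simp only [ContinuousMap.sub_apply, ContinuousMap.smul_apply, smul_eq_mul,
      continuousMap_sum_map_apply] at this
    rw [sum_map_sub_eq, ← this, one_mul]
  rw [hgz, mul_zero, add_zero] at hI1
  have hdpos : ∀ a ∈ s, 0 < f z - expConv a f z := fun a ha => by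
    have := congrArg (fun φ : C(ℝ, ℝ) => φ z) (hfa a ha)
    simp only [ContinuousMap.sub_apply, ContinuousMap.smul_apply, smul_eq_mul] at this
    rw [this]
    exact mul_pos (hs a ha) (expConv_pos (hs a ha) hz0 hbelow)
  have hfz : 0 < f z := hfpos z hz0
  -- The positive weights `f z - expConv a f z` sum to `f z` because `g z = 0`. Under them the
  -- average of the coefficients is `s.sum - z`, although every coefficient is smaller than that.
  have hkey : (s.map fun a => a * (f z - expConv a f z)).sum = (s.sum - z) * f z := by
    have : (s.map fun a => a * (f z - expConv a f z)).sum =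
        (s.map fun a => a * f z).sum - (s.map fun a => a * expConv a f z).sum := by
      rw [← Multiset.sum_map_sub]
      simp only [mul_sub]
    rw [this, ← hI0, Multiset.sum_map_mul_right, Multiset.map_id', sub_mul]
  have hlt : (s.map fun a => a * (f z - expConv a f z)).sum <
      (s.map fun a => (s.sum - z) * (f z - expConv a f z)).sum := by
    obtain ⟨a, ha⟩ := Multiset.exists_mem_of_ne_zero hz
    refine Multiset.sum_lt_sum (fun b hb => ?_) ⟨a, ha, ?_⟩
    · exact mul_le_mul_of_nonneg_right (by linarith [hxs b hb, hzA.1.2]) (hdpos b hb).le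
    · exact mul_lt_mul_of_pos_right (by linarith [hxs a ha, hzA.1.2]) (hdpos a ha)
  rw [hkey, Multiset.sum_map_mul_left, ← hI1] at hlt
  exact lt_irrefl _ hlt

/-- Let `F` be the distribution function with both `a` and `b` present, and `f` its density.
Deleting `b` gives `F + b f`, deleting `a` gives `F + a f`, and `f > 0`. -/
lemma hypoexpCDF_lt_of_lt {a b : ℝ} (ha : 0 ≤ a) (hab : a < b) {s : Multiset ℝ}
    (hs : ∀ c ∈ s, 0 ≤ c) {x : ℝ} (hx : 0 < x) :
    hypoexpCDF (b ::ₘ s) x < hypoexpCDF (a ::ₘ s) x := by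
  set t := (a ::ₘ b ::ₘ s).filter (· ≠ 0) with ht
  have hb : 0 < b := ha.trans_lt hab
  have htpos : ∀ c ∈ t, 0 < c := by
    intro c hc
    rw [ht, Multiset.mem_filter] at hc
    refine lt_of_le_of_ne ?_ (Ne.symm hc.2)
    rcases Multiset.mem_cons.mp hc.1 with rfl | h
    · exact ha
    rcases Multiset.mem_cons.mp h with rfl | h
    · exact hb.le
    · exact hs c h
  have htne : t ≠ 0 := by
    intro h0
    have : b ∈ t := by simp [ht, hb.ne']
    simp [h0] at this
  obtain ⟨f, hf, hpos⟩ := exists_density htpos htne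
  rw [ht, hypoexpCDF_filter] at hf
  have h1 := hypoexpCDF_eq_add_deriv hf
  have hf' := hf
  rw [Multiset.cons_swap] at hf'
  have h2 := hypoexpCDF_eq_add_deriv hf'
  rw [h1, h2, Multiset.cons_swap b a]
  have := hpos x hx
  simp only [ContinuousMap.add_apply, ContinuousMap.smul_apply, smul_eq_mul]
  nlinarith

/-- Averaging the largest coefficient with another one decreases the distribution function. -/
lemma hypoexpCDF_transfer_lt {a b c d : ℝ} {s : Multiset ℝ} (hb : 0 ≤ b) (hc : 0 < c) (hd : 0 < d)
    (hca : c < a) (hda : d < a) (hsum : c + d = a + b) (hs : ∀ e ∈ s, 0 ≤ e ∧ e ≤ a) {x : ℝ}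
    (hx : 0 < x) (hx' : x < a + b + s.sum) :
    hypoexpCDF (c ::ₘ d ::ₘ s) x < hypoexpCDF (a ::ₘ b ::ₘ s) x := by
  set t := (a ::ₘ b ::ₘ c ::ₘ d ::ₘ s).filter (· ≠ 0) with ht
  have ha : 0 < a := hc.trans hca
  have hba : b ≤ a := by linarith
  have hmem : ∀ e ∈ t, 0 < e ∧ e ≤ a := by
    intro e he
    rw [ht, Multiset.mem_filter] at he
    simp only [Multiset.mem_cons] at he
    have : 0 ≤ e ∧ e ≤ a := by
      rcases he.1 with rfl | rfl | rfl | rfl | h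
      · exact ⟨ha.le, le_rfl⟩
      · exact ⟨hb, hba⟩
      · exact ⟨hc.le, hca.le⟩
      · exact ⟨hd.le, hda.le⟩
      · exact hs e h
    exact ⟨lt_of_le_of_ne this.1 (Ne.symm he.2), this.2⟩
  have htsum : t.sum = a + b + (c + d + s.sum) := by
    have hfs : ∀ u : Multiset ℝ, (u.filter (· ≠ 0)).sum = u.sum := by
      intro u
      induction u using Multiset.induction_on with
      | empty => simp
      | cons e u ih =>
        by_cases he : e = 0
        · rw [Multiset.filter_cons_of_neg _ (by simpa using he), ih, he]; simp
        · rw [Multiset.filter_cons_of_pos (p := (· ≠ 0)) _ he, Multiset.sum_cons, Multiset.sum_cons, ih]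
    rw [ht, hfs]
    simp
    ring
  have hcard : 2 ≤ t.card := by
    have hle : (c ::ₘ d ::ₘ 0 : Multiset ℝ) ≤ t := by
      rw [ht, Multiset.le_filter]
      refine ⟨?_, by simp [hc.ne', hd.ne']⟩
      refine le_trans ?_ (Multiset.le_cons_self _ a)
      refine le_trans ?_ (Multiset.le_cons_self _ b)
      exact (Multiset.cons_le_cons_iff c).2 ((Multiset.cons_le_cons_iff d).2 (Multiset.zero_le _))
    simpa using Multiset.card_le_card hle
  obtain ⟨f, g, hf, hg, -⟩ := exists_second_deriv (fun e he => (hmem e he).1) hcard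
  have hpos := second_deriv_pos (fun e he => (hmem e he).1) hcard hf hg hx
    (fun e he => by rw [htsum]; linarith [(hmem e he).2])
  rw [ht, hypoexpCDF_filter] at hf
  -- Deleting two coefficients applies `(1 + a D)(1 + b D)`. Doing so with `a, b` and with `c, d`
  -- leaves only the difference of the products, as the sums agree.
  have key : ∀ {a b : ℝ} {u : Multiset ℝ}, HasD (hypoexpCDF (a ::ₘ b ::ₘ u)) f →
      hypoexpCDF u = hypoexpCDF (a ::ₘ b ::ₘ u) + (a + b) • f + (a * b) • g := by
    intro a b u hf
    have h1 := hypoexpCDF_eq_add_deriv hf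
    have h2 : HasD (hypoexpCDF (b ::ₘ u)) (f + a • g) := by
      rw [h1]; exact hf.add (hg.smul a)
    rw [hypoexpCDF_eq_add_deriv h2, h1]
    ext y
    simp
    ring
  have hperm : a ::ₘ b ::ₘ c ::ₘ d ::ₘ s = c ::ₘ d ::ₘ a ::ₘ b ::ₘ s := by
    rw [Multiset.cons_swap b c, Multiset.cons_swap a c, Multiset.cons_swap b d,
      Multiset.cons_swap a d]
  rw [key hf]
  rw [hperm] at hf
  rw [key hf, hperm, hsum]
  simp only [ContinuousMap.add_apply, ContinuousMap.smul_apply, smul_eq_mul]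
  have : a * b < c * d := by
    have : c * d - a * b = (a - c) * (a - d) := by
      have : b = c + d - a := by linarith
      rw [this]; ring
    nlinarith [mul_pos (sub_pos.2 hca) (sub_pos.2 hda)]
  nlinarith

/-- Among nonnegative coefficients of given number and sum, equal coefficients are the only
minimizer of the distribution function at a positive point below the mean. -/
lemma hypoexpCDF_replicate_lt_of_sum_eq {n : ℕ} {m : ℝ} (hm : 0 < m) (s : Multiset ℝ)
    (hs : ∀ a ∈ s, 0 ≤ a) (hcard : s.card = n) (hsum : s.sum = n * m) {x : ℝ} (hx : 0 < x)
    (hxP : x < n * m) (hne : s ≠ Multiset.replicate n m) :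
    hypoexpCDF (Multiset.replicate n m) x < hypoexpCDF s x := by
  -- The induction counts the coefficients different from `m`. A largest one `a > m` is paired with
  -- some `b < m`, and the pair is replaced by `m, a + b - m`.
  induction hk : n - s.count m using Nat.strong_induction_on generalizing s with
  | _ k ih =>
  have hsn : s ≠ 0 := by
    rintro rfl
    apply hne
    simp at hcard
    simp [← hcard]
  obtain ⟨a, has, hmax⟩ : ∃ a ∈ s, ∀ b ∈ s, b ≤ a := by
    have := s.toFinset.exists_max_image id (by simpa using hsn)
    simpa using this
  have hma : m < a := by
    by_contra hle
    push Not at hle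
    apply hne
    rw [Multiset.eq_replicate]
    refine ⟨hcard, fun b hb => ?_⟩
    by_contra hbm
    have hlt : s.sum < (s.map fun _ => m).sum := by
      have := Multiset.sum_lt_sum (s := s) (f := id) (g := fun _ => m)
        (fun c hc => (hmax c hc).trans hle) ⟨b, hb, lt_of_le_of_ne ((hmax b hb).trans hle) hbm⟩
      simpa using this
    simp [hcard, hsum] at hlt
  obtain ⟨t, rfl⟩ := Multiset.exists_cons_of_mem has
  obtain ⟨b, hbt, hbm⟩ : ∃ b ∈ t, b < m := by
    by_contra! hcon
    have h1 : t.card • m ≤ t.sum := Multiset.card_nsmul_le_sum hcon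
    simp only [Multiset.card_cons] at hcard
    rw [← hcard] at hsum
    simp at hsum
    simp at h1
    nlinarith
  obtain ⟨u, rfl⟩ := Multiset.exists_cons_of_mem hbt
  have hb0 : 0 ≤ b := hs b (by simp)
  have hlt : hypoexpCDF (m ::ₘ (a + b - m) ::ₘ u) x < hypoexpCDF (a ::ₘ b ::ₘ u) x := by
    refine hypoexpCDF_transfer_lt hb0 hm (by linarith) hma (by linarith) (by ring)
      (fun e he => ⟨hs e (by simp [he]), hmax e (by simp [he])⟩) hx ?_
    rw [← hsum] at hxP
    simpa [add_assoc] using hxP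
  by_cases heq : m ::ₘ (a + b - m) ::ₘ u = Multiset.replicate n m
  · rwa [← heq]
  · refine (ih _ ?_ (m ::ₘ (a + b - m) ::ₘ u) ?_ ?_ ?_ heq rfl).trans hlt
    · have hle := Multiset.count_le_card m (a ::ₘ b ::ₘ u)
      have hc1 : (a ::ₘ b ::ₘ u).count m = u.count m := by
        rw [Multiset.count_cons_of_ne hma.ne, Multiset.count_cons_of_ne hbm.ne']
      have hc2 : u.count m + 1 ≤ (m ::ₘ (a + b - m) ::ₘ u).count m := by
        rw [Multiset.count_cons_self]
        exact Nat.succ_le_succ (Multiset.count_le_count_cons _ _ _)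
      have hc3 : u.count m ≤ u.card := Multiset.count_le_card _ _
      simp only [Multiset.card_cons] at hcard
      omega
    · intro e he
      simp only [Multiset.mem_cons] at he
      rcases he with rfl | rfl | he
      · exact hm.le
      · linarith
      · exact hs e (by simp [he])
    · simpa using hcard
    · rw [← hsum]; simp; ring

/-- If the budget is not exhausted, raising one coefficient to use it up already lowers the
distribution function strictly. -/
lemma hypoexpCDF_replicate_lt {n : ℕ} {m : ℝ} (hm : 0 < m) (s : Multiset ℝ)
    (hs : ∀ a ∈ s, 0 ≤ a) (hcard : s.card = n) (hsum : s.sum ≤ n * m) {x : ℝ} (hx : 0 < x)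
    (hxP : x < n * m) (hne : s ≠ Multiset.replicate n m) :
    hypoexpCDF (Multiset.replicate n m) x < hypoexpCDF s x := by
  rcases hsum.lt_or_eq with hlt | heq
  · have hsn : s ≠ 0 := by
      rintro rfl
      simp at hcard
      simp [← hcard] at hlt
    obtain ⟨a, ha⟩ := Multiset.exists_mem_of_ne_zero hsn
    obtain ⟨t, rfl⟩ := Multiset.exists_cons_of_mem ha
    have ha0 := hs a ha
    simp only [Multiset.sum_cons] at hlt
    have h1 : hypoexpCDF ((n * m - t.sum) ::ₘ t) x < hypoexpCDF (a ::ₘ t) x :=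
      hypoexpCDF_lt_of_lt ha0 (by linarith) (fun c hc => hs c (by simp [hc])) hx
    by_cases he : (n * m - t.sum) ::ₘ t = Multiset.replicate n m
    · rwa [← he]
    · refine (hypoexpCDF_replicate_lt_of_sum_eq hm _ ?_ ?_ ?_ hx hxP he).trans h1
      · intro e he
        rcases Multiset.mem_cons.mp he with rfl | he
        · linarith
        · exact hs e (by simp [he])
      · simpa using hcard
      · simp
  · exact hypoexpCDF_replicate_lt_of_sum_eq hm s hs hcard heq hx hxP hne

/-- The endpoint `x = n * m`, needed for the tail at the mean, follows by continuity. -/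
lemma hypoexpCDF_replicate_le {n : ℕ} {m : ℝ} (hm : 0 < m) (s : Multiset ℝ)
    (hs : ∀ a ∈ s, 0 ≤ a) (hcard : s.card = n) (hsum : s.sum ≤ n * m) {x : ℝ} (hx : 0 < x)
    (hxP : x ≤ n * m) : hypoexpCDF (Multiset.replicate n m) x ≤ hypoexpCDF s x := by
  have hP : 0 < n * m := hx.trans_le hxP
  have hmem : x ∈ closure (Set.Ioo 0 (n * m)) := by
    rw [closure_Ioo hP.ne]; exact ⟨hx.le, hxP⟩
  refine closure_minimal (fun y hy => ?_)
    (isClosed_le (hypoexpCDF (Multiset.replicate n m)).continuous (hypoexpCDF s).continuous) hmem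
  by_cases hne : s = Multiset.replicate n m
  · rw [hne]; exact le_refl (hypoexpCDF (Multiset.replicate n m) y)
  · exact (hypoexpCDF_replicate_lt hm s hs hcard hsum hy.1 hy.2 hne).le

/-! ### Monotone hazard rate and the power bound on the tail. -/

lemma apply_zero_le_of_deriv_nonneg {u u' : ℝ → ℝ}
    (h : ∀ x, 0 ≤ x → HasDerivAt u (u' x) x ∧ 0 ≤ u' x) {x : ℝ} (hx : 0 ≤ x) : u 0 ≤ u x := by
  refine monotoneOn_of_deriv_nonneg (convex_Ici (0 : ℝ))
    (fun y hy => (h y hy).1.continuousAt.continuousWithinAt)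
    (fun y hy => (h y (interior_subset hy)).1.differentiableAt.differentiableWithinAt)
    (fun y hy => ?_) (Set.self_mem_Ici) hx hx
  rw [(h y (interior_subset hy)).1.deriv]
  exact (h y (interior_subset hy)).2

/-- The hazard rate `r = F' / (1 - F)` of `∑ aᵢ Eᵢ` is nonnegative and nondecreasing. -/
lemma exists_hazard {s : Multiset ℝ} (hs : ∀ a ∈ s, 0 < a) (hz : s ≠ 0) :
    ∃ r r' : ℝ → ℝ, ∀ x, 0 ≤ x → hypoexpCDF s x < 1 ∧
      HasDerivAt (hypoexpCDF s) (r x * (1 - hypoexpCDF s x)) x ∧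
      HasDerivAt r (r' x) x ∧ 0 ≤ r' x ∧ 0 ≤ r x := by
  induction s using Multiset.induction_on with
  | empty => exact absurd rfl hz
  | cons a s ih =>
    have ha : 0 < a := hs a (by simp)
    have hs' : ∀ b ∈ s, 0 < b := fun b hb => hs b (by simp [hb])
    by_cases hz' : s = 0
    · subst hz'
      refine ⟨fun _ => a⁻¹, fun _ => 0, fun x _ => ⟨?_, ?_, hasDerivAt_const _ _, le_rfl, by
        positivity⟩⟩
      · rw [hypoexpCDF_cons, hypoexpCDF_zero, expConv_one ha.ne']
        linarith [Real.exp_pos (-(x / a))]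
      · rw [hypoexpCDF_cons, hypoexpCDF_zero]
        exact hasD_expConv ha.ne' 1 x
    obtain ⟨r, r', hr⟩ := ih hs' hz'
    set G := hypoexpCDF s with hG
    rw [hypoexpCDF_cons, ← hG]
    set F := expConv a G with hF
    have hF' : ∀ x, HasDerivAt F (a⁻¹ * (G x - F x)) x := fun x => hasD_expConv ha.ne' G x
    have hF0 : F 0 = 0 := expConv_apply_zero ha.ne' G
    have hG0 : G 0 = 0 := hypoexpCDF_apply_zero hs' hz'
    have hexp : ∀ x, HasDerivAt (fun x : ℝ => Real.exp (x / a)) (Real.exp (x / a) * (1 / a)) x :=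
      fun x => (((hasDerivAt_id x).div_const a)).exp
    have hpos : ∀ x, 0 ≤ x → F x < 1 := by
      intro x hx
      have := apply_zero_le_of_deriv_nonneg (u := fun x => Real.exp (x / a) * (1 - F x))
        (u' := fun x => Real.exp (x / a) * (1 / a) * (1 - G x)) (fun y hy => ⟨?_, ?_⟩) hx
      · simp only [hF0, zero_div, Real.exp_zero, sub_zero, mul_one] at this
        have h1 := Real.exp_pos (x / a)
        by_contra hcon
        nlinarith
      · refine ((hexp y).mul ((hF' y).const_sub 1)).congr_deriv ?_
        field_simp
        ring
      · have := (hr y hy).1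
        have : 0 < 1 - G y := by linarith
        positivity
    -- The hazard rate after adding `a` is `(G - F) / (a (1 - F))`, and this expression carries the
    -- sign of its derivative. The factor `exp (x / a)` cancels every term of the derivative of the
    -- expression except the one with `r' ≥ 0`.
    have hkey : ∀ x, 0 ≤ x → 0 ≤ F x - G x + a * r x * (1 - F x) := by
      intro x hx
      have := apply_zero_le_of_deriv_nonneg
        (u := fun x => Real.exp (x / a) * (F x - G x + a * r x * (1 - F x)))
        (u' := fun x => Real.exp (x / a) * (a * r' x * (1 - F x))) (fun y hy => ⟨?_, ?_⟩) hx
      · have h0 := (hr 0 le_rfl).2.2.2.2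
        simp only [hF0, hG0, zero_div, Real.exp_zero, sub_zero, mul_one, zero_add, one_mul] at this
        have h1 := Real.exp_pos (x / a)
        have h2 : 0 ≤ a * r 0 := by positivity
        exact nonneg_of_mul_nonneg_right (h2.trans this) h1
      · obtain ⟨-, h1, h2, -⟩ := hr y hy
        refine ((hexp y).mul (((hF' y).sub h1).add
          ((h2.const_mul a).mul ((hF' y).const_sub 1)))).congr_deriv ?_
        simp only [Pi.add_apply, Pi.sub_apply, Pi.mul_apply]
        field_simp
        ring
      · have h1 := hpos y hy
        have h2 := (hr y hy).2.2.2.1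
        have : 0 < 1 - F y := by linarith
        positivity
    have hd : ∀ x, 0 ≤ x → HasDerivAt (fun x => a⁻¹ * (G x - F x) / (1 - F x))
        ((1 - G x) * (F x - G x + a * r x * (1 - F x)) / (a ^ 2 * (1 - F x) ^ 2)) x ∧
        0 ≤ (1 - G x) * (F x - G x + a * r x * (1 - F x)) / (a ^ 2 * (1 - F x) ^ 2) := by
      intro x hx
      have h1 := hpos x hx
      obtain ⟨h2, h3, -⟩ := hr x hx
      have h4 : 1 - F x ≠ 0 := by linarith
      refine ⟨((((h3.sub (hF' x)).const_mul a⁻¹)).div ((hF' x).const_sub 1) h4).congr_deriv ?_, ?_⟩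
      · simp only [Pi.sub_apply]
        field_simp
        ring
      · have := hkey x hx
        have : 0 < 1 - G x := by linarith
        positivity
    refine ⟨_, _, fun x hx => ⟨hpos x hx, ?_, (hd x hx).1, (hd x hx).2, ?_⟩⟩
    · refine (hF' x).congr_deriv ?_
      have h4 : 1 - F x ≠ 0 := by linarith [hpos x hx]
      field_simp
    · have := apply_zero_le_of_deriv_nonneg hd hx
      simpa [hF0, hG0] using this

/-- Log-concavity of the tail of `∑ aᵢ Eᵢ` along a ray through the origin. -/
lemma tail_mul_le_rpow {s : Multiset ℝ} (hs : ∀ a ∈ s, 0 < a) (hz : s ≠ 0) {x t : ℝ} (hx : 0 ≤ x)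
    (ht : 1 ≤ t) : 1 - hypoexpCDF s (t * x) ≤ (1 - hypoexpCDF s x) ^ t := by
  obtain ⟨r, r', hr⟩ := exists_hazard hs hz
  have hpos : ∀ x, 0 ≤ x → 0 < 1 - hypoexpCDF s x := fun x hx => by linarith [(hr x hx).1]
  have hd : ∀ x, 0 ≤ x → HasDerivAt (fun x => -Real.log (1 - hypoexpCDF s x)) (r x) x := by
    intro x hx
    refine ((((hr x hx).2.1.const_sub 1).log (hpos x hx).ne').neg).congr_deriv ?_
    have := (hpos x hx).ne'
    field_simp
  have hmono : MonotoneOn r (Set.Ici 0) :=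
    monotoneOn_of_deriv_nonneg (convex_Ici (0 : ℝ))
      (fun y hy => (hr y hy).2.2.1.continuousAt.continuousWithinAt)
      (fun y hy => (hr y (interior_subset hy)).2.2.1.differentiableAt.differentiableWithinAt)
      (fun y hy => by
        rw [(hr y (interior_subset hy)).2.2.1.deriv]; exact (hr y (interior_subset hy)).2.2.2.1)
  have hconv : ConvexOn ℝ (Set.Ici 0) fun x => -Real.log (1 - hypoexpCDF s x) := by
    refine MonotoneOn.convexOn_of_deriv (convex_Ici 0)
      (fun y hy => (hd y hy).continuousAt.continuousWithinAt)
      (fun y hy => (hd y (interior_subset hy)).differentiableAt.differentiableWithinAt) ?_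
    intro y hy z hz hyz
    rw [(hd y (interior_subset hy)).deriv, (hd z (interior_subset hz)).deriv]
    exact hmono (interior_subset hy) (interior_subset hz) hyz
  have ht0 : 0 < t := by linarith
  -- Convexity of `-log` of the tail at `x`, a point between `0` and `t * x` with weight `t⁻¹` on
  -- the latter; the value at `0` is `0`.
  have h1 := hconv.2 (Set.self_mem_Ici) (show t * x ∈ Set.Ici 0 from mul_nonneg ht0.le hx)
    (sub_nonneg.2 (inv_le_one_of_one_le₀ ht)) (inv_pos.2 ht0).le (sub_add_cancel 1 t⁻¹)
  simp only [smul_eq_mul, mul_zero, zero_add, inv_mul_cancel_left₀ ht0.ne',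
    hypoexpCDF_apply_zero hs hz, sub_zero, Real.log_one, neg_zero] at h1
  have h2 : Real.log (1 - hypoexpCDF s (t * x)) ≤ t * Real.log (1 - hypoexpCDF s x) := by
    have := mul_le_mul_of_nonneg_left h1 ht0.le
    rw [← mul_assoc, mul_inv_cancel₀ ht0.ne', one_mul] at this
    linarith
  rw [Real.rpow_def_of_pos (hpos x hx), ← Real.log_le_iff_le_exp (hpos _ (by positivity)),
    mul_comm (Real.log _)]
  exact h2

/-! ### Erlang tails and the incomplete gamma function. -/

/-- The tail `e^{-y} ∑_{k<n} y^k / k!` of the Erlang law with shape `n`. -/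
noncomputable def erlangTail (n : ℕ) (y : ℝ) : ℝ :=
  Real.exp (-y) * ∑ k ∈ Finset.range n, y ^ k / k.factorial

lemma erlangTail_succ (n : ℕ) (y : ℝ) :
    erlangTail (n + 1) y = erlangTail n y + Real.exp (-y) * (y ^ n / n.factorial) := by
  rw [erlangTail, erlangTail, Finset.sum_range_succ, mul_add]

lemma hasDerivAt_erlangTail (n : ℕ) (y : ℝ) :
    HasDerivAt (erlangTail (n + 1)) (-(Real.exp (-y) * (y ^ n / n.factorial))) y := by
  have he : HasDerivAt (fun y : ℝ => Real.exp (-y)) (-Real.exp (-y)) y := by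
    simpa using (hasDerivAt_neg y).exp
  induction n with
  | zero =>
    have : erlangTail (0 + 1) = fun y : ℝ => Real.exp (-y) := by ext; simp [erlangTail]
    rw [this]
    simpa using he
  | succ n ih =>
    have : erlangTail (n + 1 + 1) = fun y => erlangTail (n + 1) y +
      Real.exp (-y) * (y ^ (n + 1) / (n + 1).factorial) := by ext; exact erlangTail_succ _ _
    rw [this]
    refine (ih.add (he.mul ((hasDerivAt_pow (n + 1) y).div_const _))).congr_deriv ?_
    rw [Nat.factorial_succ]
    push_cast
    have : (n.factorial : ℝ) ≠ 0 := by positivity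
    field_simp
    simp

lemma continuous_erlangTail (n : ℕ) : Continuous (erlangTail n) := by
  unfold erlangTail; fun_prop

lemma erlangTail_zero_right {n : ℕ} (hn : n ≠ 0) : erlangTail n 0 = 1 := by
  obtain ⟨k, rfl⟩ := Nat.exists_eq_succ_of_ne_zero hn
  simp [erlangTail, Finset.sum_range_succ']

lemma erlangTail_pos {n : ℕ} (hn : n ≠ 0) {y : ℝ} (hy : 0 ≤ y) : 0 < erlangTail n y := by
  obtain ⟨k, rfl⟩ := Nat.exists_eq_succ_of_ne_zero hn
  refine mul_pos (Real.exp_pos _) (Finset.sum_pos' (fun i _ => by positivity) ⟨0, by simp, by simp⟩)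

lemma hypoexpCDF_replicate (n : ℕ) {m : ℝ} (hm : m ≠ 0) (x : ℝ) :
    hypoexpCDF (Multiset.replicate n m) x = 1 - erlangTail n (x / m) := by
  induction n generalizing x with
  | zero => simp [erlangTail]
  | succ n ih =>
    have hc : Continuous fun x => 1 - erlangTail (n + 1) (x / m) :=
      continuous_const.sub ((continuous_erlangTail _).comp (by fun_prop))
    have : (⟨_, hc⟩ : C(ℝ, ℝ)) = hypoexpCDF (Multiset.replicate (n + 1) m) := by
      rw [Multiset.replicate_succ, hypoexpCDF_cons]
      refine expConv_unique hm (by simp [erlangTail_zero_right]) fun x => ?_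
      have h1 := ((hasDerivAt_erlangTail n (x / m)).comp x
        ((hasDerivAt_id x).div_const m)).const_sub 1
      refine h1.congr_deriv ?_
      simp only [ContinuousMap.smul_apply, ContinuousMap.sub_apply, ContinuousMap.coe_mk, ih,
        erlangTail_succ, smul_eq_mul]
      field_simp
      ring
    rw [← this]
    rfl

/-- The function `-k! * erlangTail (k + 1)` is an antiderivative of `t ^ k * exp (-t)` and tends to
`0` at infinity. -/
lemma upperIncompleteGamma_eq {n : ℕ} (hn : 1 ≤ n) {y : ℝ} (hy : 0 ≤ y) :
    upperIncompleteGamma n y / (n - 1).factorial = erlangTail n y := by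
  obtain ⟨k, rfl⟩ := Nat.exists_eq_add_of_le' hn
  have hk : (k.factorial : ℝ) ≠ 0 := by positivity
  have hlim : Filter.Tendsto (erlangTail (k + 1)) Filter.atTop (nhds 0) := by
    have : erlangTail (k + 1) = fun y => ∑ i ∈ Finset.range (k + 1),
        (i.factorial : ℝ)⁻¹ * (y ^ i * Real.exp (-y)) := by
      ext y
      rw [erlangTail, Finset.mul_sum]
      exact Finset.sum_congr rfl fun i _ => by ring
    rw [this]
    rw [show (0 : ℝ) = ∑ i ∈ Finset.range (k + 1), (i.factorial : ℝ)⁻¹ * 0 by simp]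
    exact tendsto_finsetSum _ fun i _ =>
      (Real.tendsto_pow_mul_exp_neg_atTop_nhds_zero i).const_mul _
  have hint : ∫ t in Set.Ioi y, t ^ k * Real.exp (-t) = k.factorial * erlangTail (k + 1) y := by
    have := integral_Ioi_of_hasDerivAt_of_nonneg' (a := y)
      (g := fun t => -(k.factorial * erlangTail (k + 1) t))
      (g' := fun t => t ^ k * Real.exp (-t)) (l := 0)
      (fun t _ => (((hasDerivAt_erlangTail k t).const_mul _).neg).congr_deriv (by field_simp))
      (fun t ht => mul_nonneg (pow_nonneg (hy.trans (le_of_lt ht)) _) (Real.exp_pos _).le)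
      (by simpa using (hlim.const_mul (k.factorial : ℝ)).neg)
    rw [this]
    ring
  rw [upperIncompleteGamma]
  simp only [Nat.add_sub_cancel]
  have hcongr : ∀ t : ℝ, t ^ (((k + 1 : ℕ) : ℝ) - 1) * Real.exp (-t) = t ^ k * Real.exp (-t) := by
    intro t
    push_cast
    rw [add_sub_cancel_right, Real.rpow_natCast]
  simp only [hcongr]
  rw [hint]
  field_simp

/-! ### Comparison of levels above the mean with one level below it. -/

/-- The quotient of the factorials is the product of `n - j, ..., n + j`, and `(n + i) * (n - i) ≤ n
^ 2`. -/
lemma factorial_add_le (n j : ℕ) (hj : j < n) :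
    (n + j).factorial ≤ n ^ (2 * j + 1) * (n - 1 - j).factorial := by
  induction j with
  | zero =>
    obtain ⟨k, rfl⟩ := Nat.exists_eq_add_of_le' (Nat.one_le_of_lt hj)
    simp [Nat.factorial_succ]
  | succ j ih =>
    obtain ⟨k, rfl⟩ := Nat.exists_eq_add_of_le' hj
    have e1 : k + (j + 1).succ - 1 - j = k + 1 := by simp; omega
    have e2 : k + (j + 1).succ - 1 - (j + 1) = k := by simp
    have h := ih (by omega)
    rw [e1, Nat.factorial_succ] at h
    rw [e2, ← add_assoc, Nat.factorial_succ]
    generalize hn : k + (j + 1).succ = n at *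
    have hle : (n + j + 1) * (k + 1) ≤ n ^ 2 := by
      have : n = k + 1 + (j + 1) := by omega
      subst this; nlinarith
    calc (n + j + 1) * (n + j).factorial
        ≤ (n + j + 1) * (n ^ (2 * j + 1) * ((k + 1) * k.factorial)) := Nat.mul_le_mul_left _ h
      _ = ((n + j + 1) * (k + 1)) * (n ^ (2 * j + 1) * k.factorial) := by ring
      _ ≤ n ^ 2 * (n ^ (2 * j + 1) * k.factorial) := Nat.mul_le_mul_right _ hle
      _ = n ^ (2 * (j + 1) + 1) * k.factorial := by ring

/-- The mean of an Erlang law is at least its median. -/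
lemma erlangTail_self_le_half (n : ℕ) : erlangTail n n ≤ 1 / 2 := by
  -- Reflection pairs the term of index `n - 1 - j` with the larger term of index `n + j`, so the
  -- first `n` terms of the series of `exp n` make up at most half of it.
  have h1 : ∑ k ∈ Finset.range n, (n : ℝ) ^ k / k.factorial ≤
      ∑ j ∈ Finset.range n, (n : ℝ) ^ (n + j) / (n + j).factorial := by
    rw [← Finset.sum_range_reflect]
    refine Finset.sum_le_sum fun j hj => ?_
    have hj' := Finset.mem_range.mp hj
    rw [div_le_div_iff₀ (by positivity) (by positivity)]
    have h := factorial_add_le n j hj'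
    have e : n + j = (n - 1 - j) + (2 * j + 1) := by omega
    calc (n : ℝ) ^ (n - 1 - j) * (n + j).factorial
        ≤ (n : ℝ) ^ (n - 1 - j) * (n ^ (2 * j + 1) * (n - 1 - j).factorial) := by
          gcongr; exact_mod_cast h
      _ = (n : ℝ) ^ (n + j) * (n - 1 - j).factorial := by
          conv_rhs => rw [e, pow_add]
          ring
  have h2 := Real.sum_le_exp_of_nonneg (Nat.cast_nonneg (α := ℝ) n) (n + n)
  rw [Finset.sum_range_add] at h2
  have h3 : ∑ k ∈ Finset.range n, (n : ℝ) ^ k / k.factorial ≤ Real.exp n / 2 := by linarith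
  calc erlangTail n n ≤ Real.exp (-n) * (Real.exp n / 2) :=
        mul_le_mul_of_nonneg_left h3 (Real.exp_pos _).le
    _ = 1 / 2 := by rw [mul_div_assoc', ← Real.exp_add]; simp

/-- This is `y * exp (-y) ≤ exp (-1)` at `y = L * s`. -/
lemma mul_rpow_le {q L s : ℝ} (hq0 : 0 < q) (hq : q ≤ Real.exp (-L)) (hL : 0 < L) (hs : 0 < s) :
    L * (s * q ^ s) ≤ Real.exp (-1) := by
  have h1 : q ^ s ≤ Real.exp (-(L * s)) := by
    calc q ^ s ≤ (Real.exp (-L)) ^ s := Real.rpow_le_rpow hq0.le hq hs.le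
      _ = Real.exp (-(L * s)) := by rw [← Real.exp_mul]; ring_nf
  have h2 := Real.add_one_le_exp (L * s - 1)
  calc L * (s * q ^ s) ≤ L * (s * Real.exp (-(L * s))) := by gcongr
    _ = (L * s - 1 + 1) * Real.exp (-(L * s)) := by ring
    _ ≤ Real.exp (L * s - 1) * Real.exp (-(L * s)) := by gcongr
    _ = Real.exp (-1) := by rw [← Real.exp_add]; ring_nf

/-- Strict Bernoulli inequality with exponent `t / s`; equivalently, `log (1 + P t) / t` decreases
in `t`. -/
lemma log_one_add_mul_lt {P s t : ℝ} (hP : 0 < P) (hs : 0 < s) (hst : s < t) :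
    Real.log (1 + P * t) < t / s * Real.log (1 + P * s) := by
  have h := one_add_mul_self_lt_rpow_one_add (s := P * s) (p := t / s) (by nlinarith)
    (by positivity) (by rwa [one_lt_div hs])
  rw [show t / s * (P * s) = P * t by field_simp] at h
  have h0 : 0 < 1 + P * s := by positivity
  have := Real.log_lt_log (by have := hs.trans hst; positivity) h
  rwa [Real.log_rpow h0] at this

/-- Trading the logarithms for their arguments removes `P`: it suffices to find `L` and `s₀`
satisfying two numerical inequalities that depend on `n` only. -/
lemma exists_better_of_bound {n : ℕ} {P L s₀ : ℝ} (hn : n ≠ 0) (hP : 0 < P) (hL : 0 < L)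
    (h0 : 0 < s₀) (h1 : s₀ < 1) (hq : erlangTail n n ≤ Real.exp (-L))
    (hQ : Real.exp (-1) ≤ L * (s₀ * erlangTail n (n * s₀))) {s : ℝ} (hs : 1 ≤ s) :
    erlangTail n n ^ s * Real.log (1 + P * s) <
      erlangTail n (n * s₀) * Real.log (1 + P * s₀) := by
  have hs0 : 0 < s := by linarith
  have hqpos : 0 < erlangTail n n := erlangTail_pos hn (Nat.cast_nonneg n)
  have h2 := (mul_rpow_le hqpos hq hL hs0).trans hQ
  have h3 : s * erlangTail n n ^ s ≤ s₀ * erlangTail n (n * s₀) := le_of_mul_le_mul_left h2 hL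
  have h4 : 0 < Real.log (1 + P * s₀) := Real.log_pos (by nlinarith)
  calc erlangTail n n ^ s * Real.log (1 + P * s)
      < erlangTail n n ^ s * (s / s₀ * Real.log (1 + P * s₀)) := by
        have := Real.rpow_pos_of_pos hqpos s
        exact mul_lt_mul_of_pos_left (log_one_add_mul_lt hP h0 (by linarith)) this
    _ = (s * erlangTail n n ^ s) / s₀ * Real.log (1 + P * s₀) := by ring
    _ ≤ (s₀ * erlangTail n (n * s₀)) / s₀ * Real.log (1 + P * s₀) := by gcongr
    _ = erlangTail n (n * s₀) * Real.log (1 + P * s₀) := by field_simp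

/-- For `n = 1` the criterion free of `P` fails, since `s * exp (-s) < exp (-1)` for `s < 1`.
Instead `P < (1 + P) * log (1 + P)` shows that the throughput already decreases strictly from some
`c < 1` on. -/
lemma exists_better_one {P : ℝ} (hP : 0 < P) :
    ∃ c ∈ Set.Ioo (0 : ℝ) 1, ∀ s, 1 ≤ s →
      Real.exp (-s) * Real.log (1 + P * s) < Real.exp (-c) * Real.log (1 + P * c) := by
  have hcont : ContinuousAt (fun c : ℝ => (1 + P * c) * Real.log (1 + P * c)) 1 := by
    refine ContinuousAt.mul (by fun_prop) (ContinuousAt.log (by fun_prop) ?_)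
    nlinarith
  have h1 : P < (1 + P * 1) * Real.log (1 + P * 1) := by
    have h := Real.log_lt_sub_one_of_pos (x := (1 + P)⁻¹) (by positivity)
      (inv_lt_one_of_one_lt₀ (by linarith)).ne
    rw [Real.log_inv] at h
    have h2 : 1 - (1 + P)⁻¹ < Real.log (1 + P) := by linarith
    have h3 := mul_lt_mul_of_pos_left h2 (show 0 < 1 + P by positivity)
    rw [mul_sub, mul_inv_cancel₀ (by positivity)] at h3
    rw [mul_one]; linarith
  obtain ⟨c, hc, hc1⟩ : ∃ c ∈ Set.Ioo (0 : ℝ) 1, P < (1 + P * c) * Real.log (1 + P * c) := by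
    have hev := (hcont.eventually (lt_mem_nhds h1)).filter_mono
      (nhdsWithin_le_nhds (s := Set.Iio (1 : ℝ)))
    have hev2 : ∀ᶠ c in nhdsWithin (1 : ℝ) (Set.Iio 1), c ∈ Set.Ioo (0 : ℝ) 1 :=
      Ioo_mem_nhdsLT one_pos
    obtain ⟨c, h, h'⟩ := (hev.and hev2).exists
    exact ⟨c, h', h⟩
  refine ⟨c, hc, fun s hs => ?_⟩
  have hd : ∀ y, c ≤ y → HasDerivAt (fun s => Real.exp (-s) * Real.log (1 + P * s))
      (Real.exp (-y) * (P / (1 + P * y) - Real.log (1 + P * y))) y := by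
    intro y hy
    have hy0 : 0 < y := hc.1.trans_le hy
    have e1 : HasDerivAt (fun y : ℝ => Real.exp (-y)) (-Real.exp (-y)) y := by
      simpa using (hasDerivAt_neg y).exp
    have e2 : HasDerivAt (fun y : ℝ => 1 + P * y) P y := by
      simpa using ((hasDerivAt_id y).const_mul P).const_add 1
    refine (e1.mul (e2.log (by positivity))).congr_deriv ?_
    ring
  have hanti : StrictAntiOn (fun s => Real.exp (-s) * Real.log (1 + P * s)) (Set.Ici c) := by
    refine strictAntiOn_of_deriv_neg (convex_Ici c)
      (fun y hy => (hd y hy).continuousAt.continuousWithinAt) fun y hy => ?_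
    rw [interior_Ici] at hy
    have hy : c < y := hy
    have hy0 : 0 < y := hc.1.trans hy
    rw [(hd y hy.le).deriv]
    refine mul_neg_of_pos_of_neg (Real.exp_pos _) (sub_neg.2 ?_)
    rw [div_lt_iff₀ (by positivity)]
    have hc0 := hc.1
    have : (1 + P * c) * Real.log (1 + P * c) ≤ (1 + P * y) * Real.log (1 + P * y) := by
      have : 0 ≤ Real.log (1 + P * c) := Real.log_nonneg (by nlinarith)
      have hle : 1 + P * c ≤ 1 + P * y := by gcongr
      exact mul_le_mul hle (Real.log_le_log (by positivity) hle) this (by positivity)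
    linarith
  exact hanti Set.self_mem_Ici (show c ≤ s by linarith [hc.2]) (by linarith [hc.2])

/-- Rational bounds for the numerical cases: decimals of `e` treat the integer part of the exponent,
a Taylor polynomial the fractional part. -/
lemma le_exp_nat_add (k : ℕ) {f : ℝ} (hf : 0 ≤ f) :
    2.7182 ^ k * (∑ i ∈ Finset.range 6, f ^ i / i.factorial) ≤ Real.exp (k + f) := by
  rw [Real.exp_add, ← mul_one (k : ℝ), Real.exp_nat_mul]
  have h1 : (2.7182 : ℝ) ≤ Real.exp 1 := by have := Real.exp_one_gt_d9; linarith
  gcongr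
  exact Real.sum_le_exp_of_nonneg hf 6

lemma exp_nat_add_le (k : ℕ) {f : ℝ} (hf : 0 ≤ f) (hf1 : f ≤ 1) :
    Real.exp (k + f) ≤ 2.7183 ^ k *
      (∑ i ∈ Finset.range 5, f ^ i / i.factorial + f ^ 5 * 6 / (120 * 5)) := by
  rw [Real.exp_add, ← mul_one (k : ℝ), Real.exp_nat_mul]
  have h1 : Real.exp 1 ≤ 2.7183 := by have := Real.exp_one_lt_d9; linarith
  gcongr
  refine (Real.exp_bound' hf hf1 (n := 5) (by norm_num)).trans (le_of_eq ?_)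
  norm_num [Nat.factorial]

lemma erlangTail_le_exp_neg {n : ℕ} {y L : ℝ}
    (h : ∑ k ∈ Finset.range n, y ^ k / k.factorial ≤ Real.exp (y - L)) :
    erlangTail n y ≤ Real.exp (-L) := by
  calc erlangTail n y ≤ Real.exp (-y) * Real.exp (y - L) :=
        mul_le_mul_of_nonneg_left h (Real.exp_pos _).le
    _ = Real.exp (-L) := by rw [← Real.exp_add]; ring_nf

lemma exp_neg_one_le {n : ℕ} {y c : ℝ}
    (h : Real.exp (y - 1) ≤ c * ∑ k ∈ Finset.range n, y ^ k / k.factorial) :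
    Real.exp (-1) ≤ c * erlangTail n y := by
  calc Real.exp (-1) = Real.exp (-y) * Real.exp (y - 1) := by rw [← Real.exp_add]; ring_nf
    _ ≤ Real.exp (-y) * (c * ∑ k ∈ Finset.range n, y ^ k / k.factorial) :=
        mul_le_mul_of_nonneg_left h (Real.exp_pos _).le
    _ = c * erlangTail n y := by rw [erlangTail]; ring

lemma hypoexpCDF_add_replicate_zero (s : Multiset ℝ) (k : ℕ) :
    hypoexpCDF (s + Multiset.replicate k 0) = hypoexpCDF s := by
  induction k with
  | zero => simp
  | succ k ih => rw [Multiset.replicate_succ, Multiset.add_cons, hypoexpCDF_cons, ih]; simp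

/-- For a relative level `s ≤ 1` the Erlang tail increases with the shape. -/
lemma erlangTail_mono {k n : ℕ} (hk : k ≠ 0) (hkn : k ≤ n) {s : ℝ} (h0 : 0 < s) (h1 : s ≤ 1) :
    erlangTail k (k * s) ≤ erlangTail n (n * s) := by
  have hn : n ≠ 0 := by omega
  have hk' : (k : ℝ) ≠ 0 := by exact_mod_cast hk
  have hn' : (n : ℝ) ≠ 0 := by exact_mod_cast hn
  -- The competitor has `k` coefficients `1 / k` padded with zeros, against `n` coefficients `1 /
  -- n`; both sums are `1`.
  have h := hypoexpCDF_replicate_le (n := n) (m := (n : ℝ)⁻¹) (by positivity)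
    (Multiset.replicate k (k : ℝ)⁻¹ + Multiset.replicate (n - k) 0) ?_ ?_ ?_ h0 ?_
  · rw [hypoexpCDF_add_replicate_zero, hypoexpCDF_replicate _ (by positivity),
      hypoexpCDF_replicate _ (by positivity), div_inv_eq_mul, div_inv_eq_mul, mul_comm s,
      mul_comm s] at h
    linarith
  · intro a ha
    rcases Multiset.mem_add.mp ha with h | h
    · rw [Multiset.eq_of_mem_replicate h]; positivity
    · rw [Multiset.eq_of_mem_replicate h]
  · simp; omega
  · simp [hk', hn']
  · rwa [mul_inv_cancel₀ hn']

/-- A rate below `log (1 + P)` with equal powers beats every rate above `log (1 + P)`. -/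
lemma exists_better {n : ℕ} (hn : 1 ≤ n) {P : ℝ} (hP : 0 < P) :
    ∃ c ∈ Set.Ioo (0 : ℝ) 1, ∀ s, 1 ≤ s →
      erlangTail n n ^ s * Real.log (1 + P * s) < erlangTail n (n * c) * Real.log (1 + P * c) := by
  rcases hn.eq_or_lt with rfl | hn1
  · obtain ⟨c, hc, h⟩ := exists_better_one hP
    refine ⟨c, hc, fun s hs => ?_⟩
    have e : ∀ y, erlangTail 1 y = Real.exp (-y) := fun y => by simp [erlangTail]
    rw [e, e, ← Real.exp_mul]
    simpa using h s hs
  suffices h : ∃ L c : ℝ, 0 < L ∧ 0 < c ∧ c < 1 ∧ erlangTail n n ≤ Real.exp (-L) ∧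
      Real.exp (-1) ≤ L * c * erlangTail n (n * c) by
    obtain ⟨L, c, hL, h0, h1, hq, hQ⟩ := h
    exact ⟨c, ⟨h0, h1⟩, fun s hs =>
      exists_better_of_bound (by omega) hP hL h0 h1 hq (by rwa [← mul_assoc]) hs⟩
  by_cases h7 : 7 ≤ n
  -- Here `0.693 < log 2` comes from the median bound, and monotonicity in the shape reduces the
  -- second inequality to `n = 7`, where `7 * 0.7 - 1 = 3 + 0.9`.
  · refine ⟨0.693, 0.7, by norm_num, by norm_num, by norm_num, ?_, ?_⟩
    · refine (erlangTail_self_le_half n).trans ?_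
      rw [← Real.log_le_iff_le_exp (by norm_num), one_div, Real.log_inv]
      have := Real.log_two_gt_d9
      linarith
    · refine le_trans ?_ (mul_le_mul_of_nonneg_left
        (erlangTail_mono (k := 7) (by norm_num) h7 (s := 0.7) (by norm_num) (by norm_num))
        (by norm_num))
      apply exp_neg_one_le
      have := exp_nat_add_le 3 (f := 0.9) (by norm_num) (by norm_num)
      norm_num [Finset.sum_range_succ, Nat.factorial] at this ⊢
      linarith
  push Not at h7
  interval_cases n
  -- For `n` from `2` to `6` a value of `L` above `log 2` is available. The arguments `k, f` split
  -- `n - L` and `n * c - 1` into integer and fractional parts.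
  · refine ⟨0.9, 0.8, by norm_num, by norm_num, by norm_num, erlangTail_le_exp_neg ?_,
      exp_neg_one_le ?_⟩
    · have := le_exp_nat_add 1 (f := 0.1) (by norm_num)
      norm_num [Finset.sum_range_succ, Nat.factorial] at this ⊢
      linarith
    · have := exp_nat_add_le 0 (f := 0.6) (by norm_num) (by norm_num)
      norm_num [Finset.sum_range_succ, Nat.factorial] at this ⊢
      linarith
  · refine ⟨0.83, 0.8, by norm_num, by norm_num, by norm_num, erlangTail_le_exp_neg ?_,
      exp_neg_one_le ?_⟩
    · have := le_exp_nat_add 2 (f := 0.17) (by norm_num)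
      norm_num [Finset.sum_range_succ, Nat.factorial] at this ⊢
      linarith
    · have := exp_nat_add_le 1 (f := 0.4) (by norm_num) (by norm_num)
      norm_num [Finset.sum_range_succ, Nat.factorial] at this ⊢
      linarith
  · refine ⟨0.83, 0.8, by norm_num, by norm_num, by norm_num, erlangTail_le_exp_neg ?_,
      exp_neg_one_le ?_⟩
    · have := le_exp_nat_add 3 (f := 0.17) (by norm_num)
      norm_num [Finset.sum_range_succ, Nat.factorial] at this ⊢
      linarith
    · have := exp_nat_add_le 2 (f := 0.2) (by norm_num) (by norm_num)
      norm_num [Finset.sum_range_succ, Nat.factorial] at this ⊢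
      linarith
  · refine ⟨0.8, 0.7, by norm_num, by norm_num, by norm_num, erlangTail_le_exp_neg ?_,
      exp_neg_one_le ?_⟩
    · have := le_exp_nat_add 4 (f := 0.2) (by norm_num)
      norm_num [Finset.sum_range_succ, Nat.factorial] at this ⊢
      linarith
    · have := exp_nat_add_le 2 (f := 0.5) (by norm_num) (by norm_num)
      norm_num [Finset.sum_range_succ, Nat.factorial] at this ⊢
      linarith
  · refine ⟨0.8, 0.7, by norm_num, by norm_num, by norm_num, erlangTail_le_exp_neg ?_,
      exp_neg_one_le ?_⟩
    · have := le_exp_nat_add 5 (f := 0.2) (by norm_num)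
      norm_num [Finset.sum_range_succ, Nat.factorial] at this ⊢
      linarith
    · have := exp_nat_add_le 3 (f := 0.2) (by norm_num) (by norm_num)
      norm_num [Finset.sum_range_succ, Nat.factorial] at this ⊢
      linarith

/-! ### The complex Gaussian law and its unitary invariance. -/

lemma measurable_complex_mk : Measurable fun p : ℝ × ℝ => (⟨p.1, p.2⟩ : ℂ) :=
  Complex.measurableEquivRealProd.symm.measurable

instance : IsProbabilityMeasure stdComplexGaussian :=
  Measure.isProbabilityMeasure_map measurable_complex_mk.aemeasurable

lemma charFun_stdComplexGaussian (t : ℂ) :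
    charFun stdComplexGaussian t = Complex.exp (-(‖t‖ ^ 2 : ℝ) / 4) := by
  rw [charFun_apply, stdComplexGaussian, integral_map measurable_complex_mk.aemeasurable
    (by fun_prop)]
  have h1 : ∀ p : ℝ × ℝ, Complex.exp ((inner ℝ (⟨p.1, p.2⟩ : ℂ) t : ℝ) * Complex.I) =
      Complex.exp (t.re * p.1 * Complex.I) * Complex.exp (t.im * p.2 * Complex.I) := by
    intro p
    rw [← Complex.exp_add]
    congr 1
    simp only [Complex.inner, Complex.mul_re, Complex.conj_re, Complex.conj_im]
    push_cast
    ring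
  simp_rw [h1]
  rw [integral_prod_mul (fun x : ℝ => Complex.exp (t.re * x * Complex.I))
    (fun x : ℝ => Complex.exp (t.im * x * Complex.I)), ← charFun_apply_real, ← charFun_apply_real,
    charFun_gaussianReal, charFun_gaussianReal, ← Complex.exp_add]
  congr 1
  rw [← Complex.normSq_eq_norm_sq, Complex.normSq_apply]
  push_cast
  ring

/-- The law of a vector of independent `CN(0,1)` variables is invariant under unitary maps. -/
lemma map_mulVec_pi_stdComplexGaussian {n : ℕ} (M : Matrix (Fin n) (Fin n) ℂ)
    (hM : M * M.conjTranspose = 1) :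
    (Measure.pi fun _ : Fin n => stdComplexGaussian).map (fun v => M.mulVec v) =
      Measure.pi fun _ => stdComplexGaussian := by
  have hmeas : Measurable fun v : Fin n → ℂ => M.mulVec v :=
    (Continuous.matrix_mulVec continuous_const continuous_id).measurable
  have : IsProbabilityMeasure
      ((Measure.pi fun _ : Fin n => stdComplexGaussian).map fun v => M.mulVec v) :=
    Measure.isProbabilityMeasure_map hmeas.aemeasurable
  rw [← charFun_eq_pi_iff]
  intro t
  -- The adjoint moves the unitary map onto the frequency, and the characteristic function depends
  -- only on the norm of the frequency.
  set u : Fin n → ℂ := M.conjTranspose.mulVec t.ofLp with hu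
  have hL : Measurable (WithLp.toLp 2 : (Fin n → ℂ) → PiLp 2 fun _ : Fin n => ℂ) :=
    (MeasurableEquiv.toLp 2 (Fin n → ℂ)).measurable
  have hdot : ∀ v w : Fin n → ℂ, (∑ i, inner ℝ (v i) (w i) : ℝ) = (star v ⬝ᵥ w).re := by
    intro v w
    simp [dotProduct, Complex.inner, mul_comm]
  have h1 : charFun (((Measure.pi fun _ : Fin n => stdComplexGaussian).map
      fun v => M.mulVec v).map (WithLp.toLp 2)) t =
      charFun ((Measure.pi fun _ : Fin n => stdComplexGaussian).map (WithLp.toLp 2))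
        (WithLp.toLp 2 u) := by
    rw [charFun_apply, charFun_apply, integral_map hL.aemeasurable (by fun_prop),
      integral_map hmeas.aemeasurable, integral_map hL.aemeasurable (by fun_prop)]
    · congr 1
      ext v
      rw [PiLp.inner_apply, PiLp.inner_apply]
      simp only
      rw [hdot, hdot, hu, Matrix.star_mulVec, Matrix.dotProduct_mulVec]
    · refine Measurable.aestronglyMeasurable ?_
      exact (by fun_prop : Measurable fun x : PiLp 2 fun _ : Fin n => ℂ =>
        Complex.exp ((inner ℝ x t : ℝ) * Complex.I)).comp hL
  rw [h1, charFun_pi]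
  simp only [charFun_stdComplexGaussian, ← Complex.exp_sum]
  congr 1
  rw [← Finset.sum_div, ← Finset.sum_div]
  congr 1
  rw [Finset.sum_neg_distrib, Finset.sum_neg_distrib, ← Complex.ofReal_sum, ← Complex.ofReal_sum]
  congr 2
  have hsq : ∀ v : Fin n → ℂ, ∑ i, ‖v i‖ ^ 2 = (star v ⬝ᵥ v).re := by
    intro v
    rw [← hdot]
    simp
  rw [hsq, hsq, hu, Matrix.star_mulVec, ← Matrix.dotProduct_mulVec, Matrix.conjTranspose_conjTranspose,
    Matrix.mulVec_mulVec, hM, Matrix.one_mulVec]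

/-! ### Squared moduli are exponential; the law of the quadratic form. -/

lemma lintegral_two_mul_exp_neg_sq {r : ℝ} (hr : 0 ≤ r) :
    ∫⁻ ρ in Set.Ioc 0 √r, ENNReal.ofReal (2 * ρ * Real.exp (-ρ ^ 2)) =
      ENNReal.ofReal (1 - Real.exp (-r)) := by
  have hc : Continuous fun ρ : ℝ => 2 * ρ * Real.exp (-ρ ^ 2) := by fun_prop
  rw [← ofReal_integral_eq_lintegral_ofReal]
  · congr 1
    rw [← intervalIntegral.integral_of_le (Real.sqrt_nonneg r),
      intervalIntegral.integral_eq_sub_of_hasDerivAt (f := fun ρ => -Real.exp (-ρ ^ 2))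
      (fun ρ _ => ?_) (hc.intervalIntegrable _ _)]
    · rw [Real.sq_sqrt hr]; simp; ring
    · refine (((hasDerivAt_pow 2 ρ).neg).exp.neg).congr_deriv ?_
      simp; ring
  · exact (hc.intervalIntegrable _ _).1
  · filter_upwards [ae_restrict_mem measurableSet_Ioc] with ρ hρ
    have := hρ.1
    positivity

lemma stdComplexGaussian_normSq_le {r : ℝ} (hr : 0 ≤ r) :
    stdComplexGaussian {z | Complex.normSq z ≤ r} = ENNReal.ofReal (1 - Real.exp (-r)) := by
  have hms : MeasurableSet {z : ℂ | Complex.normSq z ≤ r} :=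
    measurableSet_le Complex.continuous_normSq.measurable measurable_const
  have hv : (1 / 2 : NNReal) ≠ 0 := by norm_num
  rw [stdComplexGaussian, Measure.map_apply measurable_complex_mk hms,
    gaussianReal_of_var_ne_zero 0 hv, prod_withDensity (measurable_gaussianPDF _ _)
      (measurable_gaussianPDF _ _), withDensity_apply _ (measurable_complex_mk hms),
    ← lintegral_indicator (measurable_complex_mk hms), ← Measure.volume_eq_prod,
    ← lintegral_comp_polarCoord_symm]
  have hpdf : ∀ x y : ℝ, gaussianPDF 0 (1 / 2) x * gaussianPDF 0 (1 / 2) y =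
      ENNReal.ofReal (Real.pi⁻¹ * Real.exp (-(x ^ 2 + y ^ 2))) := by
    intro x y
    rw [gaussianPDF, gaussianPDF, ← ENNReal.ofReal_mul (gaussianPDFReal_nonneg _ _ _)]
    congr 1
    simp only [gaussianPDFReal]
    have hpi := Real.pi_pos
    have e : √(2 * Real.pi * ((1 / 2 : NNReal) : ℝ)) = √Real.pi := by
      congr 1; push_cast; ring
    rw [e]
    have h2 : (√Real.pi)⁻¹ * (√Real.pi)⁻¹ = Real.pi⁻¹ := by
      rw [← mul_inv, Real.mul_self_sqrt hpi.le]
    rw [mul_mul_mul_comm, h2, ← Real.exp_add]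
    congr 2
    push_cast
    ring
  -- The integrand is radial; the factor `1` stands for the angular part, so that the integral
  -- splits as a product. The angle contributes `2 π`, which cancels the normalization.
  have hint : ∀ p ∈ polarCoord.target, ENNReal.ofReal p.1 •
      ({q : ℝ × ℝ | Complex.normSq ⟨q.1, q.2⟩ ≤ r}.indicator
        (fun z => gaussianPDF 0 (1 / 2) z.1 * gaussianPDF 0 (1 / 2) z.2)) (polarCoord.symm p) =
      (Set.Ioc 0 √r).indicator
        (fun ρ => ENNReal.ofReal (2 * ρ * Real.exp (-ρ ^ 2)) * ENNReal.ofReal (2 * Real.pi)⁻¹) p.1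
      * 1 := by
    rintro ⟨ρ, θ⟩ hp
    simp only [polarCoord_target, Set.mem_prod, Set.mem_Ioi] at hp
    have hsq : (ρ * Real.cos θ) ^ 2 + (ρ * Real.sin θ) ^ 2 = ρ ^ 2 := by
      have := Real.sin_sq_add_cos_sq θ
      linear_combination ρ ^ 2 * this
    have hiff : ρ ∈ Set.Ioc 0 √r ↔
        polarCoord.symm (ρ, θ) ∈ {q : ℝ × ℝ | Complex.normSq ⟨q.1, q.2⟩ ≤ r} := by
      simp only [polarCoord_symm_apply, Set.mem_ofPred_eq, Complex.normSq_mk, ← sq, hsq,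
        Set.mem_Ioc, hp.1, true_and]
      rw [Real.le_sqrt hp.1.le hr]
    by_cases hm : ρ ∈ Set.Ioc 0 √r
    · rw [Set.indicator_of_mem hm, Set.indicator_of_mem (hiff.1 hm), hpdf]
      simp only [polarCoord_symm_apply, hsq, smul_eq_mul, mul_one]
      rw [← ENNReal.ofReal_mul hp.1.le, ← ENNReal.ofReal_mul (by have := hp.1; positivity)]
      congr 1
      have := Real.pi_pos
      field_simp
    · rw [Set.indicator_of_notMem hm, Set.indicator_of_notMem (fun h => hm (hiff.2 h))]
      simp
  have hset : (fun p : ℝ × ℝ => (⟨p.1, p.2⟩ : ℂ)) ⁻¹' {z | Complex.normSq z ≤ r} =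
    {q : ℝ × ℝ | Complex.normSq ⟨q.1, q.2⟩ ≤ r} := rfl
  rw [hset, setLIntegral_congr_fun polarCoord.open_target.measurableSet hint, polarCoord_target,
    Measure.volume_eq_prod, ← Measure.prod_restrict, lintegral_prod_mul (g := fun _ : ℝ => 1)]
  · rw [lintegral_indicator measurableSet_Ioc, Measure.restrict_restrict measurableSet_Ioc,
      Set.inter_eq_left.2 Set.Ioc_subset_Ioi_self, lintegral_mul_const _ (by fun_prop),
      lintegral_two_mul_exp_neg_sq hr, lintegral_one, Measure.restrict_apply_univ,
      Real.volume_Ioo, mul_assoc, ← ENNReal.ofReal_mul (by have := Real.pi_pos; positivity)]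
    have : (2 * Real.pi)⁻¹ * (Real.pi - -Real.pi) = 1 := by
      have := Real.pi_pos
      field_simp
      ring
    rw [this, ENNReal.ofReal_one, mul_one]
  · exact (Measurable.indicator (by fun_prop) measurableSet_Ioc).aemeasurable
  · exact aemeasurable_const

lemma hasLaw_normSq : HasLaw Complex.normSq (expMeasure 1) stdComplexGaussian where
  aemeasurable := Complex.continuous_normSq.measurable.aemeasurable
  map_eq := by
    have hm := Complex.continuous_normSq.measurable
    have := isProbabilityMeasure_expMeasure (zero_lt_one' ℝ)
    have : IsProbabilityMeasure (stdComplexGaussian.map Complex.normSq) :=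
      Measure.isProbabilityMeasure_map hm.aemeasurable
    refine Measure.eq_of_cdf _ _ (StieltjesFunction.ext fun r => ?_)
    rw [cdf_expMeasure_eq one_pos, cdf_eq_real, measureReal_def,
      Measure.map_apply hm measurableSet_Iic]
    have hset : Complex.normSq ⁻¹' Set.Iic r = {z | Complex.normSq z ≤ r} := rfl
    rw [hset]
    split_ifs with hr
    · rw [stdComplexGaussian_normSq_le hr, ENNReal.toReal_ofReal, one_mul]
      have := Real.exp_le_one_iff.2 (neg_nonpos.2 hr)
      linarith
    · have : {z | Complex.normSq z ≤ r} = ∅ := by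
        ext z
        have := Complex.normSq_nonneg z
        simp
        linarith
      simp [this]

/-- Conditioning on `E` gives the convolution integral. Strict events and positive levels suffice,
since only slices with `x - a * y > 0` contribute; this also covers `X = 0`, where `φ = 1`. -/
lemma measure_mul_add_lt {Ω : Type*} [MeasurableSpace Ω] {μ : Measure Ω} [IsProbabilityMeasure μ]
    {E X : Ω → ℝ} (hE : HasLaw E (expMeasure 1) μ) (hX : AEMeasurable X μ) (hEX : IndepFun E X μ)
    (hX0 : ∀ ω, 0 ≤ X ω) {φ : C(ℝ, ℝ)} (hφ : ∀ x, 0 < x → μ.real {ω | X ω < x} = φ x)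
    {a : ℝ} (ha : 0 < a) {x : ℝ} (hx : 0 < x) :
    μ.real {ω | a * E ω + X ω < x} = expConv a φ x := by
  have hφ0 : ∀ y, 0 < y → 0 ≤ φ y := fun y hy => by rw [← hφ y hy]; exact measureReal_nonneg
  have hms : MeasurableSet {p : ℝ × ℝ | a * p.1 + p.2 < x} :=
    measurableSet_lt (by fun_prop) measurable_const
  have := isProbabilityMeasure_expMeasure (zero_lt_one' ℝ)
  have : IsProbabilityMeasure (μ.map X) := Measure.isProbabilityMeasure_map hX
  have hpair : μ {ω | a * E ω + X ω < x} = ((expMeasure 1).prod (μ.map X))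
      {p : ℝ × ℝ | a * p.1 + p.2 < x} := by
    rw [← hE.map_eq, ← (indepFun_iff_map_prod_eq_prod_map_map hE.aemeasurable hX).1 hEX,
      Measure.map_apply_of_aemeasurable (hE.aemeasurable.prodMk hX) hms]
    rfl
  have hslice : ∀ y, μ.map X (Prod.mk y ⁻¹' {p : ℝ × ℝ | a * p.1 + p.2 < x}) =
      (Set.Iio (x / a)).indicator (fun y => ENNReal.ofReal (φ (x - a * y))) y := by
    intro y
    have hset : Prod.mk y ⁻¹' {p : ℝ × ℝ | a * p.1 + p.2 < x} = Set.Iio (x - a * y) := by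
      ext z; simp [lt_sub_iff_add_lt']
    rw [hset, Measure.map_apply_of_aemeasurable hX measurableSet_Iio]
    have hset2 : X ⁻¹' Set.Iio (x - a * y) = {ω | X ω < x - a * y} := rfl
    rw [hset2]
    by_cases hy : y < x / a
    · rw [Set.indicator_of_mem (show y ∈ Set.Iio (x / a) from hy)]
      rw [lt_div_iff₀' ha] at hy
      rw [← hφ _ (by linarith), measureReal_def, ENNReal.ofReal_toReal (measure_ne_top _ _)]
    · rw [Set.indicator_of_notMem (show y ∉ Set.Iio (x / a) from hy)]
      rw [not_lt, div_le_iff₀' ha] at hy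
      have : {ω | X ω < x - a * y} = ∅ := by
        ext ω
        have := hX0 ω
        simp
        linarith
      simp [this]
  have hc : Continuous fun y => Real.exp (-y) * φ (x - a * y) := by fun_prop
  have hxa : 0 < x / a := div_pos hx ha
  have hlint : ((expMeasure 1).prod (μ.map X)) {p : ℝ × ℝ | a * p.1 + p.2 < x} =
      ∫⁻ y in Set.Ico 0 (x / a), ENNReal.ofReal (Real.exp (-y) * φ (x - a * y)) := by
    rw [Measure.prod_apply hms]
    simp only [hslice]
    have hexp : expMeasure 1 = volume.withDensity (exponentialPDF 1) := rfl
    have hmpdf : Measurable (exponentialPDF 1) :=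
      (measurable_exponentialPDFReal 1).ennreal_ofReal
    rw [hexp, lintegral_withDensity_eq_lintegral_mul _ hmpdf
      (Measurable.indicator (by fun_prop) measurableSet_Iio),
      ← lintegral_indicator measurableSet_Ico]
    congr 1
    ext y
    simp only [Pi.mul_apply]
    by_cases hy0 : 0 ≤ y
    · rw [exponentialPDF_of_nonneg hy0]
      by_cases hy : y < x / a
      · rw [Set.indicator_of_mem (show y ∈ Set.Iio (x / a) from hy),
          Set.indicator_of_mem (show y ∈ Set.Ico 0 (x / a) from ⟨hy0, hy⟩),
          ← ENNReal.ofReal_mul (by positivity)]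
        simp
      · rw [Set.indicator_of_notMem (show y ∉ Set.Iio (x / a) from hy),
          Set.indicator_of_notMem (fun h : y ∈ Set.Ico 0 (x / a) => hy h.2), mul_zero]
    · rw [exponentialPDF_of_neg (not_le.1 hy0),
        Set.indicator_of_notMem (fun h : y ∈ Set.Ico 0 (x / a) => hy0 h.1), zero_mul]
  have hnonneg : 0 ≤ᵐ[volume.restrict (Set.Ico 0 (x / a))]
      fun y => Real.exp (-y) * φ (x - a * y) := by
    filter_upwards [ae_restrict_mem measurableSet_Ico] with y hy
    have h2 := (lt_div_iff₀' ha).1 hy.2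
    exact mul_nonneg (Real.exp_pos _).le (hφ0 _ (by linarith))
  have hint : Integrable (fun y => Real.exp (-y) * φ (x - a * y))
      (volume.restrict (Set.Ico 0 (x / a))) :=
    (hc.integrableOn_Icc (a := 0) (b := x / a)).mono_set Set.Ico_subset_Icc_self
  rw [measureReal_def, hpair, hlint, ← ofReal_integral_eq_lintegral_ofReal hint hnonneg,
    ENNReal.toReal_ofReal (integral_nonneg_of_ae hnonneg), integral_Ico_eq_integral_Ioc,
    ← intervalIntegral.integral_of_le hxa.le, expConv_apply ha.ne',
    ← intervalIntegral.integral_const_mul]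
  have hsub := intervalIntegral.integral_comp_sub_mul
    (fun z => Real.exp (-(x / a)) * (φ z * Real.exp (z / a))) ha.ne' x (a := 0) (b := x / a)
  rw [mul_div_cancel₀ x ha.ne', sub_self, mul_zero, sub_zero] at hsub
  calc ∫ y in (0 : ℝ)..x / a, Real.exp (-y) * φ (x - a * y)
      = ∫ y in (0 : ℝ)..x / a,
          Real.exp (-(x / a)) * (φ (x - a * y) * Real.exp ((x - a * y) / a)) := by
        refine intervalIntegral.integral_congr fun y _ => ?_
        have : Real.exp (-y) = Real.exp (-(x / a)) * Real.exp ((x - a * y) / a) := by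
          rw [← Real.exp_add]
          congr 1
          field_simp
          ring
        simp only [this]
        ring
    _ = _ := hsub
    _ = _ := by
        rw [smul_eq_mul, ← intervalIntegral.integral_const_mul]
        refine intervalIntegral.integral_congr fun y _ => ?_
        field_simp

lemma measure_sum_lt {Ω ι : Type*} [MeasurableSpace Ω] {μ : Measure Ω} [IsProbabilityMeasure μ]
    {E : ι → Ω → ℝ} (hE : ∀ i, HasLaw (E i) (expMeasure 1) μ) (hind : iIndepFun E μ)
    (hE0 : ∀ i ω, 0 ≤ E i ω) {l : ι → ℝ} (hl : ∀ i, 0 ≤ l i) (s : Finset ι) {x : ℝ} (hx : 0 < x) :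
    μ.real {ω | ∑ i ∈ s, l i * E i ω < x} = hypoexpCDF (s.val.map l) x := by
  classical
  induction s using Finset.induction_on generalizing x with
  | empty => simp [hx]
  | insert i s hi ih =>
    simp only [Finset.sum_insert hi, Finset.insert_val_of_notMem hi, Multiset.map_cons,
      hypoexpCDF_cons]
    rcases (hl i).eq_or_lt with h0 | hpos
    · simpa [← h0] using ih hx
    · have hX : AEMeasurable (fun ω => ∑ j ∈ s, l j * E j ω) μ :=
        Finset.aemeasurable_fun_sum _ fun j _ => (hE j).aemeasurable.const_mul _
      refine measure_mul_add_lt (hE i) hX ?_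
        (fun ω => Finset.sum_nonneg fun j _ => mul_nonneg (hl j) (hE0 j ω)) (fun y hy => ih hy)
        hpos hx
      have h1 := hind.indepFun_finset₀ {i} s (by simpa using hi) fun j => (hE j).aemeasurable
      have hm1 : Measurable fun f : ({i} : Finset ι) → ℝ => f ⟨i, by simp⟩ := measurable_pi_apply _
      have hm2 : Measurable fun f : s → ℝ => ∑ j : s, l j * f j := by fun_prop
      have h2 := h1.comp hm1 hm2
      refine h2.congr (Filter.EventuallyEq.rfl) (Filter.Eventually.of_forall fun ω => ?_)
      simp only [Function.comp]
      exact Finset.sum_coe_sort s fun j => l j * E j ω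

lemma vecMul_dotProduct_diagonal_re {n : ℕ} (l : Fin n → ℝ) (w : Fin n → ℂ) :
    (w ⬝ᵥ (Matrix.diagonal fun i => (l i : ℂ)).mulVec (star w)).re =
      ∑ i, l i * Complex.normSq (w i) := by
  rw [dotProduct, Complex.re_sum]
  refine Finset.sum_congr rfl fun i _ => ?_
  rw [Matrix.mulVec_diagonal, Pi.star_apply, mul_left_comm]
  simp [Complex.mul_conj]

/-- The power gain `h Q h†` is distributed as the sum of independent standard exponential variables
weighted by the eigenvalues of `Q`. -/
lemma measure_le_quadForm {Ω : Type*} [MeasurableSpace Ω] {μ : Measure Ω} [IsProbabilityMeasure μ]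
    {n : ℕ} {h : Fin n → Ω → ℂ} (hh : IsRayleighChannel h μ) {Q : Matrix (Fin n) (Fin n) ℂ}
    (hQ : Q.PosSemidef) {x : ℝ} (hx : 0 < x) :
    μ.real {ω | x ≤ ((fun i => h i ω) ⬝ᵥ Q.mulVec (star fun i => h i ω)).re} =
      1 - hypoexpCDF ((Finset.univ : Finset (Fin n)).val.map hQ.1.eigenvalues) x := by
  set U : Matrix (Fin n) (Fin n) ℂ := (hQ.1.eigenvectorUnitary).1 with hU
  have hUU : star U * U = 1 := Unitary.coe_star_mul_self _
  -- The channel is a row vector, so the rotated vector `h U` is `U.transpose` acting on a column.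
  set M := U.transpose with hM
  have hMM : M * M.conjTranspose = 1 := by
    have : M.conjTranspose = (star U).transpose := rfl
    rw [this, hM, ← Matrix.transpose_mul, hUU, Matrix.transpose_one]
  set W : Fin n → Ω → ℂ := fun i ω => M.mulVec (fun j => h j ω) i with hW
  have hha : ∀ i, AEMeasurable (h i) μ := fun i => (hh.hasLaw i).aemeasurable
  have hhv : AEMeasurable (fun ω i => h i ω) μ := aemeasurable_pi_lambda _ hha
  have hmeas : Measurable fun v : Fin n → ℂ => M.mulVec v :=
    (Continuous.matrix_mulVec continuous_const continuous_id).measurable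
  have hWlaw : μ.map (fun ω i => W i ω) = Measure.pi fun _ => stdComplexGaussian := by
    have h1 := (iIndepFun_iff_map_fun_eq_pi_map hha).1 hh.indep
    simp only [fun i => (hh.hasLaw i).map_eq] at h1
    rw [← map_mulVec_pi_stdComplexGaussian M hMM, ← h1,
      AEMeasurable.map_map_of_aemeasurable hmeas.aemeasurable hhv]
    rfl
  have hWa : ∀ i, AEMeasurable (W i) μ := fun i =>
    ((measurable_pi_apply i).comp hmeas).comp_aemeasurable hhv
  have hWi : ∀ i, HasLaw (W i) stdComplexGaussian μ := fun i => by
    refine ⟨hWa i, ?_⟩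
    have h2 : μ.map (W i) = (μ.map fun ω i => W i ω).map (fun v => v i) := by
      rw [AEMeasurable.map_map_of_aemeasurable (measurable_pi_apply i).aemeasurable
        (aemeasurable_pi_lambda _ hWa)]
      rfl
    rw [h2, hWlaw]
    exact (measurePreserving_eval (fun _ : Fin n => stdComplexGaussian) i).map_eq
  have hWind : iIndepFun W μ := by
    rw [iIndepFun_iff_map_fun_eq_pi_map hWa, hWlaw]
    simp only [fun i => (hWi i).map_eq]
  have hE := measure_sum_lt (μ := μ) (E := fun i ω => Complex.normSq (W i ω))
    (fun i => hasLaw_normSq.fun_comp (hWi i))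
    (hWind.comp (fun _ => Complex.normSq) fun _ => Complex.continuous_normSq.measurable)
    (fun i ω => Complex.normSq_nonneg _) (hQ.eigenvalues_nonneg) Finset.univ hx
  have hquad : ∀ ω, ((fun i => h i ω) ⬝ᵥ Q.mulVec (star fun i => h i ω)).re =
      ∑ i, hQ.1.eigenvalues i * Complex.normSq (W i ω) := by
    intro ω
    set v : Fin n → ℂ := fun i => h i ω with hv
    have hw : (fun i => W i ω) = Matrix.vecMul v U := by
      rw [← Matrix.mulVec_transpose]
    have hspec : Q = U * Matrix.diagonal (fun i => (hQ.1.eigenvalues i : ℂ)) * star U := by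
      conv_lhs => rw [hQ.1.spectral_theorem, Unitary.conjStarAlgAut_apply]
      rfl
    rw [← vecMul_dotProduct_diagonal_re, hw, Matrix.star_vecMul, ← Matrix.star_eq_conjTranspose,
      ← Matrix.dotProduct_mulVec, Matrix.mulVec_mulVec, Matrix.mulVec_mulVec]
    conv_lhs => rw [hspec]
  have hnull : NullMeasurableSet {ω | ∑ i, hQ.1.eigenvalues i * Complex.normSq (W i ω) < x} μ :=
    nullMeasurableSet_lt (Finset.aemeasurable_fun_sum _ fun j _ =>
      (Complex.continuous_normSq.measurable.comp_aemeasurable (hWa j)).const_mul _)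
      aemeasurable_const
  rw [← hE, ← probReal_compl_eq_one_sub₀ hnull]
  congr 1
  ext ω
  simp [hquad]

/-! ### Eigenvalues of covariance matrices and throughput bounds. -/

lemma posSemidef_equalPower {n : ℕ} {P : ℝ} (hP : 0 ≤ P) : (equalPower n P).PosSemidef := by
  rw [equalPower]
  exact Matrix.PosSemidef.one.smul (by rw [Complex.zero_le_real]; positivity)

lemma equalPower_mem {n : ℕ} (hn : 1 ≤ n) {P : ℝ} (hP : 0 ≤ P) :
    equalPower n P ∈ admissibleCovariances n P := by
  refine ⟨posSemidef_equalPower hP, le_of_eq ?_⟩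
  have : (n : ℝ) ≠ 0 := by positivity
  rw [equalPower, Matrix.trace_smul, Matrix.trace_one, smul_eq_mul, Fintype.card_fin,
    ← Complex.ofReal_natCast, ← Complex.ofReal_mul, Complex.ofReal_re]
  field_simp

lemma eq_smul_one_of_eigenvalues {n : ℕ} {Q : Matrix (Fin n) (Fin n) ℂ} (hQ : Q.IsHermitian)
    {c : ℝ} (h : ∀ i, hQ.eigenvalues i = c) : Q = (c : ℂ) • (1 : Matrix (Fin n) (Fin n) ℂ) := by
  have hd : (Matrix.diagonal (RCLike.ofReal ∘ hQ.eigenvalues) : Matrix (Fin n) (Fin n) ℂ) =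
      (c : ℂ) • 1 := by
    rw [Matrix.smul_one_eq_diagonal]
    congr 1
    ext i
    simp [h i]
  rw [hQ.spectral_theorem, hd, map_smul, map_one]

lemma eigenvalues_smul_one {n : ℕ} {c : ℝ}
    (hQ : ((c : ℂ) • (1 : Matrix (Fin n) (Fin n) ℂ)).IsHermitian) (i : Fin n) :
    hQ.eigenvalues i = c := by
  have h := hQ.mulVec_eigenvectorBasis i
  rw [Matrix.smul_mulVec, Matrix.one_mulVec] at h
  have hne : (hQ.eigenvectorBasis i).ofLp ≠ 0 := by
    intro h0
    refine hQ.eigenvectorBasis.toBasis.ne_zero i ?_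
    rw [OrthonormalBasis.coe_toBasis]
    exact WithLp.ofLp_injective 2 h0
  rw [← Complex.coe_smul] at h
  exact_mod_cast (smul_left_injective ℂ hne h).symm

/-- The multiset of eigenvalues of a covariance matrix. -/
noncomputable abbrev eigenMultiset {n : ℕ} {Q : Matrix (Fin n) (Fin n) ℂ} (hQ : Q.IsHermitian) :
    Multiset ℝ := (Finset.univ : Finset (Fin n)).val.map hQ.eigenvalues

lemma sum_eigenMultiset {n : ℕ} {Q : Matrix (Fin n) (Fin n) ℂ} (hQ : Q.IsHermitian) :
    (eigenMultiset hQ).sum = Q.trace.re := by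
  rw [hQ.trace_eq_sum_eigenvalues, Complex.re_sum]
  rfl

lemma eigenMultiset_nonneg {n : ℕ} {Q : Matrix (Fin n) (Fin n) ℂ} (hQ : Q.PosSemidef) :
    ∀ a ∈ eigenMultiset hQ.1, 0 ≤ a := by
  intro a ha
  obtain ⟨i, -, rfl⟩ := Multiset.mem_map.mp ha
  exact hQ.eigenvalues_nonneg i

lemma eigenMultiset_equalPower {n : ℕ} {P : ℝ} (hQ : (equalPower n P).IsHermitian) :
    eigenMultiset hQ = Multiset.replicate n (P / n) := by
  rw [Multiset.eq_replicate]
  refine ⟨by simp, fun b hb => ?_⟩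
  obtain ⟨i, -, rfl⟩ := Multiset.mem_map.mp hb
  exact eigenvalues_smul_one (c := P / n) hQ i

lemma throughput_eq {Ω : Type*} [MeasurableSpace Ω] {μ : Measure Ω} [IsProbabilityMeasure μ]
    {n : ℕ} {h : Fin n → Ω → ℂ} (hh : IsRayleighChannel h μ) {Q : Matrix (Fin n) (Fin n) ℂ}
    (hQ : Q.PosSemidef) {x : ℝ} (hx : 0 < x) :
    throughput μ h Q (Real.log (1 + x)) =
      (1 - hypoexpCDF (eigenMultiset hQ.1) x) * Real.log (1 + x) := by
  rw [throughput, ← measure_le_quadForm hh hQ hx]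
  congr 2
  ext ω
  simp only [mutualInformation]
  have hq : 0 ≤ ((fun i => h i ω) ⬝ᵥ Q.mulVec (star fun i => h i ω)).re := by
    have := hQ.dotProduct_mulVec_nonneg (star fun i => h i ω)
    rw [star_star] at this
    exact (Complex.le_def.1 this).1
  have hiff := Real.log_le_log_iff (x := 1 + x)
    (y := 1 + ((fun i => h i ω) ⬝ᵥ Q.mulVec (star fun i => h i ω)).re) (by positivity)
    (by positivity)
  exact hiff.trans (add_le_add_iff_left 1)

lemma throughput_equalPower {Ω : Type*} [MeasurableSpace Ω] {μ : Measure Ω}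
    [IsProbabilityMeasure μ] {n : ℕ} (hn : 1 ≤ n) {P : ℝ} (hP : 0 < P) {h : Fin n → Ω → ℂ}
    (hh : IsRayleighChannel h μ) {s : ℝ} (hs : 0 < s) :
    throughput μ h (equalPower n P) (Real.log (1 + P * s)) =
      erlangTail n (n * s) * Real.log (1 + P * s) := by
  have : (n : ℝ) ≠ 0 := by positivity
  rw [throughput_eq hh (posSemidef_equalPower hP.le) (by positivity), eigenMultiset_equalPower,
    hypoexpCDF_replicate _ (by positivity)]
  congr 1
  rw [sub_sub_cancel]
  congr 1
  field_simp

/-- Rates `log (1 + P s)` with `s ≥ 1` are bounded by a power of the tail at the mean. -/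
lemma throughput_le_rpow {Ω : Type*} [MeasurableSpace Ω] {μ : Measure Ω}
    [IsProbabilityMeasure μ] {n : ℕ} (hn : 1 ≤ n) {P : ℝ} (hP : 0 < P) {h : Fin n → Ω → ℂ}
    (hh : IsRayleighChannel h μ) {Q : Matrix (Fin n) (Fin n) ℂ}
    (hQ : Q ∈ admissibleCovariances n P) {s : ℝ} (hs : 1 ≤ s) :
    throughput μ h Q (Real.log (1 + P * s)) ≤ erlangTail n n ^ s * Real.log (1 + P * s) := by
  have hn0 : (n : ℝ) ≠ 0 := by positivity
  have hs0 : 0 < s := by linarith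
  rw [throughput_eq hh hQ.1 (by positivity)]
  refine mul_le_mul_of_nonneg_right ?_ (Real.log_nonneg (by nlinarith))
  have hq0 : 0 < erlangTail n n := erlangTail_pos (by omega) (by positivity)
  have hnonneg := eigenMultiset_nonneg hQ.1
  have hsum : (eigenMultiset hQ.1.1).sum ≤ n * (P / n) := by
    rw [mul_div_cancel₀ _ hn0]
    exact (sum_eigenMultiset hQ.1.1).trans_le hQ.2
  set t := (eigenMultiset hQ.1.1).filter (· ≠ 0) with ht
  rw [← hypoexpCDF_filter, ← ht]
  -- With no positive eigenvalue the gain vanishes, and so does the tail.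
  by_cases hz : t = 0
  · rw [hz]
    simpa using (Real.rpow_pos_of_pos hq0 s).le
  have hpos : ∀ a ∈ t, 0 < a := fun a ha => by
    rw [ht, Multiset.mem_filter] at ha
    exact lt_of_le_of_ne (hnonneg a ha.1) (Ne.symm ha.2)
  have h1 := tail_mul_le_rpow hpos hz hP.le hs
  rw [mul_comm s P] at h1
  refine h1.trans (Real.rpow_le_rpow ?_ ?_ hs0.le)
  · obtain ⟨r, r', hr⟩ := exists_hazard hpos hz
    linarith [(hr P hP.le).1]
  · have h2 := hypoexpCDF_replicate_le (n := n) (m := P / n) (by positivity) _ hnonneg (by simp)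
      hsum hP (by rw [mul_div_cancel₀ _ hn0])
    rw [hypoexpCDF_replicate _ (by positivity), ← hypoexpCDF_filter (eigenMultiset _), ← ht,
      show P / (P / n) = n by field_simp] at h2
    linarith

/-- Rates `log (1 + P s)` with `s < 1`: equal power allocation is strictly better than any other. -/
lemma throughput_lt_equalPower {Ω : Type*} [MeasurableSpace Ω] {μ : Measure Ω}
    [IsProbabilityMeasure μ] {n : ℕ} (hn : 1 ≤ n) {P : ℝ} (hP : 0 < P) {h : Fin n → Ω → ℂ}
    (hh : IsRayleighChannel h μ) {Q : Matrix (Fin n) (Fin n) ℂ}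
    (hQ : Q ∈ admissibleCovariances n P) (hne : Q ≠ equalPower n P) {s : ℝ} (hs : 0 < s)
    (hs1 : s < 1) :
    throughput μ h Q (Real.log (1 + P * s)) <
      throughput μ h (equalPower n P) (Real.log (1 + P * s)) := by
  have hn0 : (n : ℝ) ≠ 0 := by positivity
  rw [throughput_eq hh hQ.1 (by positivity),
    throughput_eq hh (posSemidef_equalPower hP.le) (by positivity), eigenMultiset_equalPower]
  refine mul_lt_mul_of_pos_right ?_ (Real.log_pos (by nlinarith))
  refine sub_lt_sub_left (hypoexpCDF_replicate_lt (by positivity) _ ?_ (by simp) ?_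
    (by positivity) ?_ ?_) 1
  · exact eigenMultiset_nonneg hQ.1
  · rw [mul_div_cancel₀ _ hn0]
    exact (sum_eigenMultiset hQ.1.1).trans_le hQ.2
  · rw [mul_div_cancel₀ _ hn0]
    nlinarith
  -- A Hermitian matrix whose eigenvalues all equal `P / n` is scalar, which gives uniqueness of `Q`
  -- and not just of its spectrum.
  · intro heq
    refine hne (eq_smul_one_of_eigenvalues hQ.1.1 fun i => ?_)
    refine Multiset.eq_of_mem_replicate (n := n) ?_
    rw [← heq]
    exact Multiset.mem_map_of_mem _ (Finset.mem_univ_val i)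

/-- The throughput of equal power allocation at rate `log (1 + P s)` has a maximum over `(0, 1)`,
larger than the throughput of any covariance matrix at a rate above `log (1 + P)`. -/
lemma exists_isMaxOn_erlangTail {n : ℕ} (hn : 1 ≤ n) {P : ℝ} (hP : 0 < P) :
    ∃ c ∈ Set.Ioo (0 : ℝ) 1, 0 < erlangTail n (n * c) * Real.log (1 + P * c) ∧
      (∀ s ∈ Set.Ioo (0 : ℝ) 1, erlangTail n (n * s) * Real.log (1 + P * s) ≤
        erlangTail n (n * c) * Real.log (1 + P * c)) ∧
      ∀ s, 1 ≤ s → erlangTail n n ^ s * Real.log (1 + P * s) <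
        erlangTail n (n * c) * Real.log (1 + P * c) := by
  set φ : ℝ → ℝ := fun s => erlangTail n (n * s) * Real.log (1 + P * s) with hφ
  have hcont : ContinuousOn φ (Set.Icc 0 1) := by
    refine ContinuousOn.mul ((continuous_erlangTail n).comp (by fun_prop)).continuousOn
      (ContinuousOn.log (by fun_prop) fun s hs => ?_)
    have := hs.1
    positivity
  -- The maximum is taken over the closed interval; the better level `d` then excludes both
  -- endpoints.
  obtain ⟨c, hc, hmax⟩ := isCompact_Icc.exists_isMaxOn (Set.nonempty_Icc.2 zero_le_one) hcont
  obtain ⟨d, hd, hbetter⟩ := exists_better hn hP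
  have hdc : φ d ≤ φ c := hmax ⟨hd.1.le, hd.2.le⟩
  have hd0 : 0 < φ d := by
    have := hd.1
    exact mul_pos (erlangTail_pos (by omega) (by positivity)) (Real.log_pos (by nlinarith))
  have h1 : φ 1 < φ c := by
    have := hbetter 1 le_rfl
    rw [Real.rpow_one] at this
    refine lt_of_lt_of_le ?_ hdc
    simpa [hφ] using this
  have h0 : φ 0 < φ c := by
    refine lt_of_lt_of_le ?_ hdc
    simpa [hφ] using hd0
  refine ⟨c, ⟨lt_of_le_of_ne hc.1 ?_, lt_of_le_of_ne hc.2 ?_⟩, hd0.trans_le hdc,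
    fun s hs => hmax ⟨hs.1.le, hs.2.le⟩, fun s hs => (hbetter s hs).trans_le hdc⟩
  · rintro rfl; exact lt_irrefl _ h0
  · rintro rfl; exact lt_irrefl _ h1

end Miso

/-! ### The main theorem. -/

theorem mainTheorem1 {Ω : Type*} [MeasurableSpace Ω] (μ : Measure Ω) [IsProbabilityMeasure μ]
    (n : ℕ) (hn : 1 ≤ n) (P : ℝ) (hP : 0 < P)
    (h : Fin n → Ω → ℂ) (hh : Miso.IsRayleighChannel h μ) :
    ∃ Rm : ℝ,
      -- `Rm` is the maximum throughput over all rates and all admissible covariance matrices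
      IsGreatest {r : ℝ | ∃ Q ∈ Miso.admissibleCovariances n P, ∃ R : ℝ,
        r = Miso.throughput μ h Q R} Rm ∧
      -- it is achieved by equal power allocation
      Miso.equalPower n P ∈ Miso.admissibleCovariances n P ∧
      (∃ R : ℝ, Miso.throughput μ h (Miso.equalPower n P) R = Rm) ∧
      -- and by no other covariance matrix; optimal rates are `ln (1 + P s)` with `0 < s < 1`
      (∀ Q ∈ Miso.admissibleCovariances n P, ∀ R : ℝ, Miso.throughput μ h Q R = Rm →
        Q = Miso.equalPower n P ∧ 0 < R ∧ R < Real.log (1 + P)) ∧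
      -- the closed form of the maximum throughput
      IsGreatest ((fun s : ℝ =>
        Miso.upperIncompleteGamma n (n * s) / (n - 1).factorial * Real.log (1 + P * s)) ''
          Set.Ioo 0 1) Rm := by
  obtain ⟨c, hc, hpos, hmax, hlarge⟩ := Miso.exists_isMaxOn_erlangTail hn hP
  set Rm := Miso.erlangTail n (n * c) * Real.log (1 + P * c) with hRm
  have hEq : Miso.throughput μ h (Miso.equalPower n P) (Real.log (1 + P * c)) = Rm :=
    Miso.throughput_equalPower hn hP hh hc.1
  -- This dichotomy yields both the upper bound and the uniqueness: a pair either falls strictly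
  -- short of `Rm` or has the claimed form.
  have key : ∀ Q ∈ Miso.admissibleCovariances n P, ∀ R : ℝ, Miso.throughput μ h Q R < Rm ∨
      Miso.throughput μ h Q R ≤ Rm ∧ Q = Miso.equalPower n P ∧ 0 < R ∧ R < Real.log (1 + P) := by
    intro Q hQ R
    rcases le_or_gt R 0 with hR | hR
    · exact Or.inl ((mul_nonpos_of_nonneg_of_nonpos measureReal_nonneg hR).trans_lt hpos)
    obtain ⟨s, hs, rfl⟩ : ∃ s, 0 < s ∧ Real.log (1 + P * s) = R := by
      refine ⟨(Real.exp R - 1) / P, div_pos (by linarith [Real.add_one_lt_exp hR.ne']) hP, ?_⟩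
      rw [mul_div_cancel₀ _ hP.ne', add_sub_cancel, Real.log_exp]
    rcases le_or_gt 1 s with hs1 | hs1
    · exact Or.inl ((Miso.throughput_le_rpow hn hP hh hQ hs1).trans_lt (hlarge s hs1))
    have hle : Miso.throughput μ h (Miso.equalPower n P) (Real.log (1 + P * s)) ≤ Rm := by
      rw [Miso.throughput_equalPower hn hP hh hs]
      exact hmax s ⟨hs, hs1⟩
    by_cases hne : Q = Miso.equalPower n P
    · subst hne
      exact Or.inr ⟨hle, rfl, hR, Real.log_lt_log (by positivity) (by nlinarith)⟩
    · exact Or.inl ((Miso.throughput_lt_equalPower hn hP hh hQ hne hs hs1).trans_le hle)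
  have hmem := Miso.equalPower_mem hn hP.le
  have hgamma : ∀ s ∈ Set.Ioo (0 : ℝ) 1,
      Miso.upperIncompleteGamma n (n * s) / (n - 1).factorial = Miso.erlangTail n (n * s) :=
    fun s hs => Miso.upperIncompleteGamma_eq hn (by have := hs.1; positivity)
  refine ⟨Rm, ⟨⟨_, hmem, _, hEq.symm⟩, ?_⟩, hmem, ⟨_, hEq⟩, fun Q hQ R hR => ?_,
    ⟨c, hc, ?_⟩, ?_⟩
  · rintro _ ⟨Q, hQ, R, rfl⟩
    exact (key Q hQ R).elim le_of_lt And.left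
  · rcases key Q hQ R with hlt | hle
    · exact absurd hR hlt.ne
    · exact hle.2
  · simp only [hgamma c hc, hRm]
  · rintro _ ⟨s, hs, rfl⟩
    simp only [hgamma s hs]
    exact hmax s hs
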